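/- **Setting.** Let $N\ge 2$, let $\mathcal G$ be a connected undirected graph on the nodes $\{1,\dots,N\}$ with Laplacian $\Omega$, let $\psi_{\max}$ be the largest eigenvalue of $\Omega$ and $d_{\min}$ the minimum degree. Node $i$ has the private cost $F_i=\rho_i+\gamma_i:\mathbb R^n\to\mathbb R$, where - $\gamma_i$ is convex, differentiable and bounded below, and $\nabla\gamma_i$ is Lipschitz with constant $L_{\gamma_i}$; - $\rho_i$ is convex, its subgradients are bounded in norm by a constant $B_i>0$, and $\tau_i\|x\|_2\le\rho_i(x)$ for all $x$, where $\tau_i>0$. Put $F^*=\min_{x\in\mathbb R^n}\sum_iF_i(x)$. A tuple $\mathbf x=(x_1,\dots,x_N)\in\mathbb R^{nN}$ is *$\epsilon$-optimal* if $|\sum_iF_i(x_i)-F^*|\le\epsilon$, and *$\epsilon$-feasible* if $\|x_i-x_j\|_2\le\epsilon$ for every edge $ij$ of $\mathcal G$. **DFAL iterates.** Let $A$ be a matrix with $A^{\mathsf T}A=\Omega\otimes I_n$, so that $A\mathbf x=0$ if and only if $x_i=x_j$ on all edges. Given $c\in(0,1)$ and $\lambda^{(1)},\alpha^{(1)},\xi^{(1)}>0$,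 put $\lambda^{(k+1)}=c\lambda^{(k)}$, $\alpha^{(k+1)}=c^2\alpha^{(k)}$, $\xi^{(k+1)}=c^2\xi^{(k)}$ and $$f^{(k)}(\mathbf x)=\lambda^{(k)}\sum_i\gamma_i(x_i)+\tfrac12\|A\mathbf x-\lambda^{(k)}\theta^{(k)}\|_2^2,\qquad P^{(k)}(\mathbf x)=\lambda^{(k)}\sum_i\rho_i(x_i)+f^{(k)}(\mathbf x).$$ A sequence $(\mathbf x^{(k)})_{k\ge1}$ is a sequence of DFAL iterates if, with $\theta^{(1)}=0$ and $\theta^{(k+1)}=\theta^{(k)}-A\mathbf x^{(k)}/\lambda^{(k)}$, for every $k\ge1$ either (a) $P^{(k)}(\mathbf x^{(k)})-\min P^{(k)}\le\alpha^{(k)}$, or (b) there are $g_i\in\lambda^{(k)}\partial\rho_i(x_i^{(k)})+\nabla_{x_i}f^{(k)}(\mathbf x^{(k)})$ with $\|g_i\|_2\le\xi^{(k)}/\sqrt N$ for all $i$. **Implementation.** Given $\mathbf x^{(0)}\in\mathbb R^{nN}$ and $B_x>0$, start with $\bar{\mathbf x}^{(1)}=0$. In the $k$-th DFAL iteration put $L_i=\lambda^{(k)}L_{\gamma_i}+\psi_{\max}$,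 $\ell_{\max}=B_x\sqrt{2\sum_iL_i/\alpha^{(k)}}$, $\mathbf y^{(0)}=\bar{\mathbf y}^{(1)}=\mathbf x^{(k-1)}$, $t^{(1)}=1$, and for $\ell=1,2,\dots$ compute at every node $i$ $$q_i=\lambda^{(k)}\nabla\gamma_i(\bar y_i^{(\ell)})+\sum_j\Omega_{ij}\bigl(\bar y_j^{(\ell)}+\bar x_j^{(k)}\bigr),\qquad y_i^{(\ell)}=\mathbf{prox}_{\lambda^{(k)}\rho_i/L_i}\bigl(\bar y_i^{(\ell)}-q_i/L_i\bigr),$$ where $\mathbf{prox}_{\rho}(x)=\operatorname{argmin}_y\{\rho(y)+\frac12\|y-x\|_2^2\}$, and $t^{(\ell+1)}=\frac12\bigl(1+\sqrt{1+4(t^{(\ell)})^2}\bigr)$, $\bar{\mathbf y}^{(\ell+1)}=\mathbf y^{(\ell)}+\frac{t^{(\ell)}-1}{t^{(\ell+1)}}(\mathbf y^{(\ell)}-\mathbf y^{(\ell-1)})$. Stop at the first $\ell\ge 1$ for which there are $g_i\in q_i+\lambda^{(k)}\partial\rho_i(\bar y_i^{(\ell)})$ with $\|g_i\|_2\le\xi^{(k)}/\sqrt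 N$ for all $i$, and put then $\mathbf x^{(k)}=\bar{\mathbf y}^{(\ell)}$, or for which $\ell\ge\ell_{\max}$, and put then $\mathbf x^{(k)}=\mathbf y^{(\ell)}$ (the first rule has priority). Finally $\bar{\mathbf x}^{(k+1)}=\frac{\lambda^{(k+1)}}{\lambda^{(k)}}(\bar{\mathbf x}^{(k)}+\mathbf x^{(k)})$. A *communication* of a node is the exchange of one vector of $\mathbb R^n$ per node with its neighbours: one in every inner step (for $\bar{\mathbf y}^{(\ell)}$), and one at the end of every DFAL iteration (for $\mathbf x^{(k)}$). In every inner step node $i$ evaluates $\nabla\gamma_i$ and a proximal map of $\rho_i$ once each. **Theorem.** The minimum $F^*$ is attained. Let the functions $\rho_i,\gamma_i$ with their constants, $c\in(0,1)$, $a>0$, $0<s<\min_i\tau_i$ and $\mathbf x^{(0)}$ be given. There are $\bar\lambda>0$ and $\bar B>0$, which do not depend on the graph, such that for all parameters with $$0<\lambda^{(1)}\le\bar\lambda,\qquad 0<\alpha^{(1)}\le a(\lambda^{(1)})^2,\qquad 0<\xi^{(1)}\le s\lambda^{(1)},\qquad B_x\ge\bar B,$$ there is a constant $C>0$, which depends on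 $N$, the functions and these parameters but neither on the graph nor on $\epsilon$, such that for every connected graph $\mathcal G$ on the $N$ nodes: 1. every sequence of DFAL iterates satisfies $\lim_{k\to\infty}\sum_iF_i(x_i^{(k)})=F^*$; 2. the implementation produces a sequence of DFAL iterates; 3. for every $\epsilon\in(0,\frac12]$ there is an integer $K$ with $1\le K\le C\log(1/\epsilon)$ such that, for every sequence of DFAL iterates and every $k\ge K$, $\mathbf x^{(k)}$ is $\epsilon$-optimal and $\epsilon$-feasible; and the first $K$ DFAL iterations of the implementation require, at every node $i$, at most $C\,\dfrac{\psi_{\max}^{1.5}}{d_{\min}}\,\epsilon^{-1}$ communications, at most $C\epsilon^{-1}$ evaluations of $\nabla\gamma_i$, and at most $C\epsilon^{-1}$ evaluations of proximal maps of $\rho_i$. -/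

import Mathlib

open Set Filter Topology
open scoped NNReal

namespace DFAL

noncomputable section

/-! ### Spaces, cost classes, proximal map -/

/-- The decision space `ℝⁿ` of one node, with the Euclidean norm. -/
abbrev Vec (n : ℕ) := EuclideanSpace ℝ (Fin n)

/-- The space `ℝ^{nN}` of tuples `x = (x₁, …, x_N)` of local decisions, with the Euclidean norm. -/
abbrev Profile (N n : ℕ) := PiLp 2 (fun _ : Fin N => Vec n)

/-- The convex subdifferential `∂ρ(x)`. -/
def subdifferential {n : ℕ} (ρ : Vec n → ℝ) (x : Vec n) : Set (Vec n) :=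
  {g | ∀ y, ρ x + inner ℝ g (y - x) ≤ ρ y}

/-- The class `Γ`: convex, differentiable, with `L`-Lipschitz gradient, and bounded below. -/
structure InGamma {n : ℕ} (γ : Vec n → ℝ) (L : ℝ≥0) : Prop where
  convex : ConvexOn ℝ univ γ
  differentiable : Differentiable ℝ γ
  lipschitz : LipschitzWith L (gradient γ)
  bounded_below : BddBelow (range γ)

/-- The class `R`: convex, all subgradients bounded in norm by `B > 0`, and `τ ‖x‖ ≤ ρ x`
for all `x`, where `τ > 0`. -/
structure InR {n : ℕ} (ρ : Vec n → ℝ) (B τ : ℝ) : Prop where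
  convex : ConvexOn ℝ univ ρ
  B_pos : 0 < B
  subgradient_bound : ∀ x, ∀ g ∈ subdifferential ρ x, ‖g‖ ≤ B
  tau_pos : 0 < τ
  coercive : ∀ x, τ * ‖x‖ ≤ ρ x

/-- `p` minimizes `y ↦ f y + ½ ‖y - x‖²`. -/
def IsProx {n : ℕ} (f : Vec n → ℝ) (x p : Vec n) : Prop :=
  ∀ y, f p + 1 / 2 * ‖p - x‖ ^ 2 ≤ f y + 1 / 2 * ‖y - x‖ ^ 2

/-- The proximal map of `f`: the minimizer of `y ↦ f y + ½ ‖y - x‖²`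
(it exists and is unique for a convex `f : ℝⁿ → ℝ`). -/
def prox {n : ℕ} (f : Vec n → ℝ) (x : Vec n) : Vec n :=
  Classical.epsilon (IsProx f x)

/-! ### The optimization problem -/

/-- The private costs `F_i = ρ_i + γ_i` of the `N` nodes, given by their two parts. -/
structure Costs (N n : ℕ) where
  rho : Fin N → Vec n → ℝ
  gamma : Fin N → Vec n → ℝ

variable {N n : ℕ}

/-- The centralized objective `F(x) = ∑ i, F_i(x)`. -/
def Costs.central (P : Costs N n) (x : Vec n) : ℝ := ∑ i, (P.rho i x + P.gamma i x)

/-- `F* = min_x F(x)`. -/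
def Costs.optVal (P : Costs N n) : ℝ := ⨅ x, P.central x

/-- The separable objective `∑ i, F_i(x_i)`. -/
def Costs.total (P : Costs N n) (x : Profile N n) : ℝ := ∑ i, (P.rho i (x i) + P.gamma i (x i))

/-- `|∑ i, F_i(x_i) - F*| ≤ ε`. -/
def IsEpsOptimal (P : Costs N n) (ε : ℝ) (x : Profile N n) : Prop :=
  |P.total x - P.optVal| ≤ ε

/-- The consensus violation over the edges of `G` is at most `ε`. -/
def IsEpsFeasible (G : SimpleGraph (Fin N)) (ε : ℝ) (x : Profile N n) : Prop :=
  ∀ i j, G.Adj i j → ‖x i - x j‖ ≤ ε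

/-! ### The graph -/

open Classical in
/-- The graph Laplacian `Ω`. -/
def laplacian (G : SimpleGraph (Fin N)) : Matrix (Fin N) (Fin N) ℝ := G.lapMatrix ℝ

theorem laplacian_isHermitian (G : SimpleGraph (Fin N)) : (laplacian G).IsHermitian := by
  classical exact G.isHermitian_lapMatrix (R := ℝ)

/-- The largest eigenvalue of the Laplacian. -/
def psiMax (G : SimpleGraph (Fin N)) : ℝ := ⨆ i, (laplacian_isHermitian G).eigenvalues i

open Classical in
/-- The minimum degree. -/
def dMin (G : SimpleGraph (Fin N)) : ℕ := G.minDegree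

open Classical in
/-- The closed neighbourhood of `i`: the node itself and the nodes it can communicate with. -/
def closedNbhd (G : SimpleGraph (Fin N)) (i : Fin N) : Finset (Fin N) :=
  insert i (G.neighborFinset i)

/-! ### The first-order augmented Lagrangian scheme -/

/-- The parameters `c, λ⁽¹⁾, α⁽¹⁾, ξ⁽¹⁾`. -/
structure Params where
  c : ℝ
  lam1 : ℝ
  alpha1 : ℝ
  xi1 : ℝ

/-- `λ⁽ᵏ⁾`, `k ≥ 1`, where `λ⁽ᵏ⁺¹⁾ = c λ⁽ᵏ⁾`. -/
def Params.lam (p : Params) (k : ℕ) : ℝ := p.c ^ (k - 1) * p.lam1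

/-- `α⁽ᵏ⁾`, `k ≥ 1`, where `α⁽ᵏ⁺¹⁾ = c² α⁽ᵏ⁾`. -/
def Params.alpha (p : Params) (k : ℕ) : ℝ := (p.c ^ 2) ^ (k - 1) * p.alpha1

/-- `ξ⁽ᵏ⁾`, `k ≥ 1`, where `ξ⁽ᵏ⁺¹⁾ = c² ξ⁽ᵏ⁾`. -/
def Params.xi (p : Params) (k : ℕ) : ℝ := (p.c ^ 2) ^ (k - 1) * p.xi1

/-- The smooth part `f(x) = λ ∑ i, γ_i(x_i) + ½ ‖A x - b - λ θ‖²` of the subproblem. -/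
def smoothPart (P : Costs N n) {m : ℕ} (A : Profile N n →L[ℝ] EuclideanSpace ℝ (Fin m))
    (b : EuclideanSpace ℝ (Fin m)) (lam : ℝ) (θ : EuclideanSpace ℝ (Fin m))
    (x : Profile N n) : ℝ :=
  lam * ∑ i, P.gamma i (x i) + 1 / 2 * ‖A x - b - lam • θ‖ ^ 2

/-- The subproblem objective `P(x) = λ ∑ i, ρ_i(x_i) + f(x)`. -/
def subproblem (P : Costs N n) {m : ℕ} (A : Profile N n →L[ℝ] EuclideanSpace ℝ (Fin m))
    (b : EuclideanSpace ℝ (Fin m)) (lam : ℝ) (θ : EuclideanSpace ℝ (Fin m))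
    (x : Profile N n) : ℝ :=
  lam * ∑ i, P.rho i (x i) + smoothPart P A b lam θ x

/-- Inexactness condition (a): `P(x) - min P ≤ α`. -/
def InexactA (P : Costs N n) {m : ℕ} (A : Profile N n →L[ℝ] EuclideanSpace ℝ (Fin m))
    (b : EuclideanSpace ℝ (Fin m)) (lam alpha : ℝ) (θ : EuclideanSpace ℝ (Fin m))
    (x : Profile N n) : Prop :=
  ∃ xs, (∀ z, subproblem P A b lam θ xs ≤ subproblem P A b lam θ z) ∧
    subproblem P A b lam θ x - subproblem P A b lam θ xs ≤ alpha

/-- Inexactness condition (b): there are `g_i ∈ λ ∂ρ_i(x_i) + ∇_{x_i} f(x)` with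
`‖g_i‖ ≤ ξ / √N` for all `i`. -/
def InexactB (P : Costs N n) {m : ℕ} (A : Profile N n →L[ℝ] EuclideanSpace ℝ (Fin m))
    (b : EuclideanSpace ℝ (Fin m)) (lam xi : ℝ) (θ : EuclideanSpace ℝ (Fin m))
    (x : Profile N n) : Prop :=
  ∀ i, ∃ v ∈ subdifferential (P.rho i) (x i),
    ‖lam • v + (gradient (smoothPart P A b lam θ) x) i‖ ≤ xi / √(N : ℝ)

/-- `x⁽¹⁾, x⁽²⁾, …` and `θ⁽¹⁾, θ⁽²⁾, …` are primal and dual DFAL iterates for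
`min ∑ i, F_i(x_i)` subject to `A x = b` (the value of the sequences at `0` plays no role). -/
structure IsDFAL (P : Costs N n) (p : Params) {m : ℕ}
    (A : Profile N n →L[ℝ] EuclideanSpace ℝ (Fin m)) (b : EuclideanSpace ℝ (Fin m))
    (x : ℕ → Profile N n) (θ : ℕ → EuclideanSpace ℝ (Fin m)) : Prop where
  init : θ 1 = 0
  primal : ∀ k, 1 ≤ k →
    InexactA P A b (p.lam k) (p.alpha k) (θ k) (x k) ∨
      InexactB P A b (p.lam k) (p.xi k) (θ k) (x k)
  dual : ∀ k, 1 ≤ k → θ (k + 1) = θ k - (1 / p.lam k) • (A (x k) - b)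

/-- `Aᵀ A = Ω ⊗ I_n`. This holds for `A = Σ Vᵀ`, where `C = U Σ Vᵀ` is a reduced singular value
decomposition of the edge-node incidence matrix `C` (block row `x_i - x_j` for an edge `ij`), and
for `A = C` itself; for such `A`, the constraint `A x = 0` says `x_i = x_j` on all edges. -/
def IsConsensusMap (G : SimpleGraph (Fin N)) {m : ℕ}
    (A : Profile N n →L[ℝ] EuclideanSpace ℝ (Fin m)) : Prop :=
  ∀ (x : Profile N n) (i : Fin N),
    (ContinuousLinearMap.adjoint A (A x)) i = ∑ j, laplacian G i j • x j

/-- `x⁽¹⁾, x⁽²⁾, …` are DFAL iterates for the consensus problem over `G`, i.e. for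
`min ∑ i, F_i(x_i)` subject to `A x = 0` with `Aᵀ A = Ω ⊗ I_n`. -/
def IsConsensusDFAL (P : Costs N n) (p : Params) (G : SimpleGraph (Fin N))
    (x : ℕ → Profile N n) : Prop :=
  ∃ (m : ℕ) (A : Profile N n →L[ℝ] EuclideanSpace ℝ (Fin m)) (θ : ℕ → EuclideanSpace ℝ (Fin m)),
    IsConsensusMap G A ∧ IsDFAL P p A 0 x θ

/-! ### The distributed implementation, with counters -/

/-- For each node: the number of evaluations of `∇γ_i`, the number of evaluations of the proximal
map of a multiple of `ρ_i`, and the number of communications (one communication of node `i` is the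
exchange of one vector of `ℝⁿ` per node between `i` and its neighbours). -/
structure Cost (N : ℕ) where
  grad : Fin N → ℕ
  prox : Fin N → ℕ
  comm : Fin N → ℕ

/-- The state of the inner loop (MS-APG) before its `ℓ`-th pass: `y = y⁽ˡ⁻¹⁾`, `ybar = ȳ⁽ˡ⁾`,
`t = t⁽ˡ⁾`, and the counters. -/
structure InnerState (N n : ℕ) where
  y : Profile N n
  ybar : Profile N n
  t : ℝ
  cost : Cost N

/-- The state of the outer loop before its `k`-th pass: `x = x⁽ᵏ⁻¹⁾`, `xbar = x̄⁽ᵏ⁾`,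
and the counters. -/
structure OuterState (N n : ℕ) where
  x : Profile N n
  xbar : Profile N n
  cost : Cost N

/-- The inputs of the implementation: the costs, Lipschitz constants of the `∇γ_i`, the parameters,
the graph, and the number `B_x` that enters the limit on the number of inner passes. -/
structure Input (N n : ℕ) where
  costs : Costs N n
  L : Fin N → ℝ≥0
  params : Params
  G : SimpleGraph (Fin N)
  Bx : ℝ

/-- `L_i⁽ᵏ⁾ = λ⁽ᵏ⁾ L_{γ_i} + ψ_max`. -/
def Input.Lk (I : Input N n) (k : ℕ) (i : Fin N) : ℝ := I.params.lam k * I.L i + psiMax I.G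

/-- `ℓ_max⁽ᵏ⁾ = B_x √(2 ∑ i, L_i⁽ᵏ⁾ / α⁽ᵏ⁾)`. -/
def Input.ellMax (I : Input N n) (k : ℕ) : ℝ :=
  I.Bx * √(2 * (∑ i, I.Lk k i) / I.params.alpha k)

/-- The local gradient `q_i = λ⁽ᵏ⁾ ∇γ_i(ȳ_i) + ∑_{j ∈ N_i} Ω_{ij} (ȳ_j + x̄_j)`; it uses one
gradient evaluation, and the vectors `ȳ_j` received from the neighbours `j` of `i`. -/
def Input.q (I : Input N n) (k : ℕ) (xbar ybar : Profile N n) (i : Fin N) : Vec n :=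
  I.params.lam k • gradient (I.costs.gamma i) (ybar i)
    + ∑ j ∈ closedNbhd I.G i, laplacian I.G i j • (ybar j + xbar j)

/-- One pass of the inner loop in the `k`-th outer pass. Every node makes one gradient evaluation,
one proximal map evaluation and one communication. -/
def Input.innerStep (I : Input N n) (k : ℕ) (xbar : Profile N n) (s : InnerState N n) :
    InnerState N n :=
  let y' : Profile N n := WithLp.toLp 2 fun i =>
    DFAL.prox (fun z => I.params.lam k / I.Lk k i * I.costs.rho i z)
      (s.ybar i - (1 / I.Lk k i) • I.q k xbar s.ybar i)
  let t' : ℝ := (1 + √(1 + 4 * s.t ^ 2)) / 2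
  { y := y'
    ybar := y' + ((s.t - 1) / t') • (y' - s.y)
    t := t'
    cost :=
      { grad := fun i => s.cost.grad i + 1
        prox := fun i => s.cost.prox i + 1
        comm := fun i => s.cost.comm i + 1 } }

/-- The state of the inner loop after `m` passes in the `k`-th outer pass from the outer
state `S`. -/
def Input.inner (I : Input N n) (k : ℕ) (S : OuterState N n) (m : ℕ) : InnerState N n :=
  (I.innerStep k S.xbar)^[m] { y := S.x, ybar := S.x, t := 1, cost := S.cost }

/-- The subgradient test: there are `g_i ∈ q_i + λ⁽ᵏ⁾ ∂ρ_i(ȳ_i)` with `‖g_i‖ ≤ ξ⁽ᵏ⁾ / √N`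
for all `i`. -/
def Input.test (I : Input N n) (k : ℕ) (xbar ybar : Profile N n) : Prop :=
  ∀ i, ∃ v ∈ subdifferential (I.costs.rho i) (ybar i),
    ‖I.q k xbar ybar i + I.params.lam k • v‖ ≤ I.params.xi k / √(N : ℝ)

/-- The number of inner passes: the first `ℓ ≥ 1` such that `ȳ⁽ˡ⁾` passes the subgradient test or
`ℓ` has reached `ℓ_max⁽ᵏ⁾` (rounded up to an integer). -/
def Input.innerCount (I : Input N n) (k : ℕ) (S : OuterState N n) : ℕ :=
  sInf {ℓ : ℕ | 1 ≤ ℓ ∧ (I.test k S.xbar (I.inner k S (ℓ - 1)).ybar ∨ I.ellMax k ≤ ℓ)}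

open Classical in
/-- The output of the inner loop: `x⁽ᵏ⁾ = ȳ⁽ˡ⁾` if the last `ȳ⁽ˡ⁾` passes the subgradient test, and
`x⁽ᵏ⁾ = y⁽ˡ⁾` otherwise. -/
def Input.innerOutput (I : Input N n) (k : ℕ) (S : OuterState N n) : Profile N n :=
  let ℓ := I.innerCount k S
  if I.test k S.xbar (I.inner k S (ℓ - 1)).ybar then (I.inner k S (ℓ - 1)).ybar
  else (I.inner k S ℓ).y

/-- The `k`-th pass of the outer loop, `k ≥ 1`. After the inner loop every node communicates
`x_i⁽ᵏ⁾` once to its neighbours. -/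
def Input.outerStep (I : Input N n) (k : ℕ) (S : OuterState N n) : OuterState N n :=
  let x' := I.innerOutput k S
  let e := (I.inner k S (I.innerCount k S)).cost
  { x := x'
    xbar := (I.params.lam (k + 1) / I.params.lam k) • (S.xbar + x')
    cost := { grad := e.grad, prox := e.prox, comm := fun i => e.comm i + 1 } }

/-- The state after `k` outer passes started at `x⁽⁰⁾ = x0`; its component `x` is `x⁽ᵏ⁾`. -/
def Input.run (I : Input N n) (x0 : Profile N n) : ℕ → OuterState N n
  | 0 => { x := x0, xbar := 0, cost := { grad := 0, prox := 0, comm := 0 } }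
  | k + 1 => I.outerStep (k + 1) (I.run x0 k)

end

end DFAL

namespace DFAL

/-! ### Subgradients, descent inequality and proximal maps -/

section ConvexAnalysis

/-! The scheme is an inexact augmented Lagrangian method, and everything rests on keeping its
multipliers bounded. Multipliers stay in the range of `A`. An inexact minimizer of the subproblem
has a smooth gradient of size O(λ) in each block (`norm_smoothGrad_le`), because `ρ_i` is
`B_i`-Lipschitz and α = O(λ²), ξ = O(λ). Dividing by λ bounds the blocks of `Aᵀθ⁺` for the new
multiplier θ⁺, and on the range of `A` over a connected graph this bounds θ⁺ itself
(`IsConsensusMap.norm_map_le_of_adjoint`). The growth `τ_i ‖x‖ ≤ ρ_i x` bounds the primal iterates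
as soon as λ is small compared with the multiplier bound. These two facts form the invariant
`StepBounds`.

Since `A x = λ (θ - θ⁺)`, the consensus violation is O(λ). Comparing x with the optimal consensus
point bounds the cost from above by `F* + O(λ)`; comparing `F*` with the value at one block `x_{i₀}`
gives the matching lower bound (`StepBounds.exists_rate`). As λ decays like `c^k`, about log(1/ε)
outer passes suffice.

The inner loop is an accelerated proximal gradient method in the norm with block weights `L_i`, and
a telescoping energy gives the O(1/ℓ²) rate (`Input.energy_innerStep_le`). Hence `ℓ_max` passes
ensure accuracy α. Since `ℓ_max` grows like `1/√α`, that is like `c^{-k}`, the work of the first K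
outer passes is a geometric sum of order `c^{-K}`, which is O(1/ε).

The constants are produced for each graph separately. Uniformity in the graph, including the factor
`ψ_max^{3/2} / d_min`, comes from there being only finitely many graphs on N nodes: minima and
maxima over them are taken at the end. -/

theorem _root_.ConvexOn.continuous_of_univ {n : ℕ} {ρ : Vec n → ℝ} (h : ConvexOn ℝ univ ρ) :
    Continuous ρ := continuousOn_univ.1 (h.continuousOn isOpen_univ)

/-- Hahn–Banach separates `(x, ρ x)` from the open strict epigraph. The separating functional has
negative vertical component, and rescaling by it turns the horizontal part into a subgradient. -/
theorem subdifferential_nonempty {n : ℕ} {ρ : Vec n → ℝ} (h : ConvexOn ℝ univ ρ) (x : Vec n) :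
    (subdifferential ρ x).Nonempty := by
  have hc : Continuous ρ := h.continuous_of_univ
  have hconv : Convex ℝ {p : Vec n × ℝ | ρ p.1 < p.2} := by
    simpa using h.convex_strict_epigraph
  have hopen : IsOpen {p : Vec n × ℝ | ρ p.1 < p.2} :=
    isOpen_lt (hc.comp continuous_fst) continuous_snd
  obtain ⟨f, hf⟩ := geometric_hahn_banach_open_point (x := (x, ρ x)) hconv hopen (by simp)
  have hdec : ∀ (y : Vec n) (t : ℝ), f (y, t) = f (y, 0) + t * f (0, 1) := by
    intro y t
    have : ((y, t) : Vec n × ℝ) = (y, 0) + t • (0, 1) := by simp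
    rw [this, map_add, map_smul, smul_eq_mul]
  have hneg : f (0, 1) < 0 := by
    have := hf (x, ρ x + 1) (by simp)
    rw [hdec, hdec x (ρ x)] at this
    linarith
  have hle : ∀ y, f (y, 0) + ρ y * f (0, 1) ≤ f (x, 0) + ρ x * f (0, 1) := by
    intro y
    refine le_of_forall_pos_le_add fun ε hε => ?_
    have := hf (y, ρ y + ε / (-f (0, 1))) (by simpa using div_pos hε (neg_pos.2 hneg))
    rw [hdec, hdec x (ρ x)] at this
    have h2 : ε / (-f (0, 1)) * f (0, 1) = -ε := by
      rw [div_neg, neg_mul, div_mul_cancel₀ _ hneg.ne]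
    nlinarith
  let φ : StrongDual ℝ (Vec n) := (-f (0, 1))⁻¹ • f.comp (ContinuousLinearMap.inl ℝ (Vec n) ℝ)
  refine ⟨(InnerProductSpace.toDual ℝ (Vec n)).symm φ, fun y => ?_⟩
  rw [InnerProductSpace.toDual_symm_apply]
  have h1 : φ (y - x) = (-f (0, 1))⁻¹ * (f (y, 0) - f (x, 0)) := by
    simp [φ, map_sub]
    ring
  rw [h1]
  have h3 : (-f (0, 1))⁻¹ * (f (y, 0) - f (x, 0)) ≤ ρ y - ρ x := by
    rw [inv_mul_le_iff₀ (neg_pos.2 hneg)]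
    nlinarith [hle y]
  linarith

/-- A subgradient exists at every point and is bounded by `B`, so `ρ` is `B`-Lipschitz. -/
theorem InR.sub_le {n : ℕ} {ρ : Vec n → ℝ} {B τ : ℝ} (h : InR ρ B τ) (x y : Vec n) :
    ρ x - ρ y ≤ B * ‖x - y‖ := by
  obtain ⟨g, hg⟩ := subdifferential_nonempty h.convex x
  have h1 := hg y
  have h2 : -(‖g‖ * ‖y - x‖) ≤ inner ℝ g (y - x) := neg_le_of_abs_le (abs_real_inner_le_norm _ _)
  have h3 := mul_le_mul_of_nonneg_right (h.subgradient_bound x g hg) (norm_nonneg (y - x))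
  rw [norm_sub_rev x y]
  linarith

theorem hasDerivAt_comp_line {n : ℕ} {γ : Vec n → ℝ} (h : Differentiable ℝ γ) (x d : Vec n)
    (t : ℝ) : HasDerivAt (fun s : ℝ => γ (x + s • d)) (inner ℝ (gradient γ (x + t • d)) d) t := by
  have h1 : HasDerivAt (fun s : ℝ => x + s • d) d t := by
    simpa using ((hasDerivAt_id t).smul_const d).const_add x
  have h2 := (h (x + t • d)).hasFDerivAt.comp_hasDerivAt t h1
  rwa [← inner_gradient_left] at h2

theorem InGamma.gradient_inequality {n : ℕ} {γ : Vec n → ℝ} {L : ℝ≥0} (h : InGamma γ L)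
    (x y : Vec n) : γ x + inner ℝ (gradient γ x) (y - x) ≤ γ y := by
  have hc : ConvexOn ℝ univ (fun s : ℝ => γ (x + s • (y - x))) := by
    have := h.convex.comp_affineMap (AffineMap.lineMap (k := ℝ) x y)
    simpa [Function.comp_def, AffineMap.lineMap_apply, add_comm] using this
  have hd := hasDerivAt_comp_line h.differentiable x (y - x) 0
  have := hc.le_slope_of_hasDerivAt (mem_univ 0) (mem_univ 1) one_pos hd
  simp only [slope_def_field, zero_smul, one_smul, add_zero, sub_zero, div_one,
    add_sub_cancel] at this
  linarith

theorem InGamma.descent {n : ℕ} {γ : Vec n → ℝ} {L : ℝ≥0} (h : InGamma γ L)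
    (x d : Vec n) : γ (x + d) ≤ γ x + inner ℝ (gradient γ x) d + L / 2 * ‖d‖ ^ 2 := by
  -- The gap between `γ` on the segment and its quadratic model; the Lipschitz bound makes its
  -- derivative nonpositive.
  let φ : ℝ → ℝ := fun t =>
    γ (x + t • d) - (t * inner ℝ (gradient γ x) d + t ^ 2 * (L / 2 * ‖d‖ ^ 2))
  have hφ : ∀ t, HasDerivAt φ (inner ℝ (gradient γ (x + t • d)) d -
      (inner ℝ (gradient γ x) d + 2 * t * (L / 2 * ‖d‖ ^ 2))) t := by
    intro t
    refine (hasDerivAt_comp_line h.differentiable x d t).sub (HasDerivAt.add ?_ ?_)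
    · simpa using (hasDerivAt_id t).mul_const (inner ℝ (gradient γ x) d)
    · simpa using ((hasDerivAt_id t).pow 2).mul_const (L / 2 * ‖d‖ ^ 2 : ℝ)
  have hanti : AntitoneOn φ (Icc 0 1) := by
    refine antitoneOn_of_deriv_nonpos (convex_Icc 0 1)
      (fun t _ => (hφ t).continuousAt.continuousWithinAt)
      (fun t _ => (hφ t).differentiableAt.differentiableWithinAt) fun t ht => ?_
    rw [interior_Icc] at ht
    rw [(hφ t).deriv]
    have h1 : inner ℝ (gradient γ (x + t • d) - gradient γ x) d ≤ L * (t * ‖d‖) * ‖d‖ := by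
      refine (real_inner_le_norm _ _).trans (mul_le_mul_of_nonneg_right ?_ (norm_nonneg _))
      have := h.lipschitz.norm_sub_le (x + t • d) x
      simpa [norm_smul, abs_of_pos ht.1] using this
    rw [inner_sub_left] at h1
    nlinarith
  have := hanti (left_mem_Icc.2 zero_le_one) (right_mem_Icc.2 zero_le_one) zero_le_one
  simp only [φ, one_smul, zero_smul, add_zero] at this
  linarith

theorem exists_forall_le_of_norm_le {E : Type*} [NormedAddCommGroup E] [ProperSpace E]
    {f : E → ℝ} (hf : Continuous f) {c M : ℝ} (hc : 0 < c) (h : ∀ x, c * ‖x‖ - M ≤ f x) :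
    ∃ x, ∀ y, f x ≤ f y := by
  refine hf.exists_forall_le (tendsto_atTop_mono h ?_)
  exact tendsto_atTop_add_const_right _ _ ((tendsto_norm_cocompact_atTop (E := E)).const_mul_atTop hc)

theorem isProx_prox {n : ℕ} {f : Vec n → ℝ} (hf : Continuous f) (h0 : ∀ x, 0 ≤ f x) (x : Vec n) :
    IsProx f x (prox f x) := by
  refine Classical.epsilon_spec (p := IsProx f x) ?_
  refine exists_forall_le_of_norm_le (c := 1) (M := ‖x‖ + 1 / 2)
    (f := fun y => f y + 1 / 2 * ‖y - x‖ ^ 2) (by fun_prop) one_pos fun y => ?_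
  have h1 := norm_sub_norm_le y x
  nlinarith [h0 y, sq_nonneg (‖y - x‖ - 1)]

/-- Compare `p` with points of the segment towards `z`, divide by the step `t`, and let `t` tend to
0: the quadratic term disappears. -/
theorem IsProx.le {n : ℕ} {f : Vec n → ℝ} (hf : ConvexOn ℝ univ f) {x p : Vec n}
    (h : IsProx f x p) (z : Vec n) : f p + inner ℝ (x - p) (z - p) ≤ f z := by
  have key : ∀ t : ℝ, 0 < t → t ≤ 1 →
      f p + inner ℝ (x - p) (z - p) - f z ≤ t * (1 / 2 * ‖z - p‖ ^ 2) := by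
    intro t ht ht1
    have h1 := h ((1 - t) • p + t • z)
    have h2 := hf.2 (mem_univ p) (mem_univ z) (sub_nonneg.2 ht1) ht.le (by ring)
    have h3 : (1 - t) • p + t • z - x = (p - x) + t • (z - p) := by module
    rw [h3, norm_add_sq_real, norm_smul, inner_smul_right, Real.norm_eq_abs, abs_of_pos ht] at h1
    have h4 : inner ℝ (p - x) (z - p) = -inner ℝ (x - p) (z - p) := by
      rw [← inner_neg_left, neg_sub]
    rw [h4] at h1
    simp only [smul_eq_mul] at h2
    have : t * (f p + inner ℝ (x - p) (z - p) - f z) ≤ t * (t * (1 / 2 * ‖z - p‖ ^ 2)) := by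
      nlinarith
    exact le_of_mul_le_mul_left this ht
  by_contra hcon
  push Not at hcon
  have hlim : Tendsto (fun t : ℝ => t * (1 / 2 * ‖z - p‖ ^ 2)) (𝓝[>] 0) (𝓝 0) := by
    have : Tendsto (fun t : ℝ => t * (1 / 2 * ‖z - p‖ ^ 2)) (𝓝 0) (𝓝 (0 * (1 / 2 * ‖z - p‖ ^ 2))) :=
      (continuous_id.mul continuous_const).tendsto 0
    rw [zero_mul] at this
    exact this.mono_left nhdsWithin_le_nhds
  have := ge_of_tendsto hlim (b := f p + inner ℝ (x - p) (z - p) - f z) (by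
    filter_upwards [Ioc_mem_nhdsGT (zero_lt_one (α := ℝ))] with t ht using key t ht.1 ht.2)
  linarith

end ConvexAnalysis

/-! ### The Laplacian, consensus maps and connectivity -/

section Graph

variable {N n : ℕ}

open Classical in
theorem laplacian_apply (G : SimpleGraph (Fin N)) (i j : Fin N) :
    laplacian G i j = (if i = j then (G.degree i : ℝ) else 0) - if G.Adj i j then 1 else 0 := by
  simp [laplacian, SimpleGraph.lapMatrix, SimpleGraph.degMatrix, Matrix.diagonal_apply,
    SimpleGraph.adjMatrix_apply]

open Classical in
theorem sum_laplacian_smul {E : Type*} [AddCommGroup E] [Module ℝ E] (G : SimpleGraph (Fin N))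
    (x : Fin N → E) (i : Fin N) :
    ∑ j, laplacian G i j • x j = ∑ j, if G.Adj i j then x i - x j else 0 := by
  simp only [laplacian_apply, sub_smul, Finset.sum_sub_distrib, ite_smul, zero_smul, one_smul,
    Finset.sum_ite_eq, Finset.mem_univ, if_true]
  rw [SimpleGraph.degree_eq_sum_if_adj, Finset.sum_smul, ← Finset.sum_sub_distrib]
  refine Finset.sum_congr rfl fun j _ => ?_
  split_ifs <;> simp

open Classical in
-- Symmetrization over the two orientations of each edge; the factor 1/2 is there because ordered
-- pairs count every edge twice.
theorem sum_inner_laplacian (G : SimpleGraph (Fin N)) (x y : Fin N → Vec n) :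
    ∑ i, inner ℝ (∑ j, laplacian G i j • x j) (y i) =
      1 / 2 * ∑ i, ∑ j, if G.Adj i j then inner ℝ (x i - x j) (y i - y j) else 0 := by
  have h1 : ∑ i, inner ℝ (∑ j, laplacian G i j • x j) (y i) =
      ∑ i, ∑ j, if G.Adj i j then inner ℝ (x i - x j) (y i) else 0 := by
    refine Finset.sum_congr rfl fun i _ => ?_
    rw [sum_laplacian_smul, sum_inner]
    refine Finset.sum_congr rfl fun j _ => ?_
    split_ifs <;> simp
  have h2 : ∑ i, ∑ j, (if G.Adj i j then inner ℝ (x i - x j) (y i) else 0) =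
      ∑ i, ∑ j, if G.Adj i j then -inner ℝ (x i - x j) (y j) else 0 := by
    rw [Finset.sum_comm]
    refine Finset.sum_congr rfl fun i _ => Finset.sum_congr rfl fun j _ => ?_
    rw [G.adj_comm, ← inner_neg_left, neg_sub]
  have h3 : ∑ i, ∑ j, (if G.Adj i j then inner ℝ (x i - x j) (y i - y j) else 0) =
      ∑ i, ∑ j, (if G.Adj i j then inner ℝ (x i - x j) (y i) else 0) +
      ∑ i, ∑ j, (if G.Adj i j then -inner ℝ (x i - x j) (y j) else 0) := by
    simp only [← Finset.sum_add_distrib]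
    refine Finset.sum_congr rfl fun i _ => Finset.sum_congr rfl fun j _ => ?_
    split_ifs
    · rw [inner_sub_right]; ring
    · simp
  rw [h1, h3, ← h2]
  ring

theorem sum_closedNbhd (G : SimpleGraph (Fin N)) (x : Fin N → Vec n) (i : Fin N) :
    ∑ j ∈ closedNbhd G i, laplacian G i j • x j = ∑ j, laplacian G i j • x j := by
  classical
  refine Finset.sum_subset (Finset.subset_univ _) fun j _ hj => ?_
  simp only [closedNbhd, Finset.mem_insert, SimpleGraph.mem_neighborFinset, not_or] at hj
  rw [laplacian_apply, if_neg (Ne.symm hj.1), if_neg hj.2]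
  simp

theorem le_psiMax (G : SimpleGraph (Fin N)) (i : Fin N) :
    (laplacian_isHermitian G).eigenvalues i ≤ psiMax G :=
  le_ciSup (Set.finite_range _).bddAbove i

/-- The spectrum of `ψ_max - Ω` consists of the numbers `ψ_max` minus an eigenvalue, so this matrix
is positive semidefinite. -/
theorem dotProduct_laplacian_le (G : SimpleGraph (Fin N)) (u : Fin N → ℝ) :
    ∑ i, (∑ j, laplacian G i j * u j) * u i ≤ psiMax G * ∑ i, u i ^ 2 := by
  have hpsd : (algebraMap ℝ (Matrix (Fin N) (Fin N) ℝ) (psiMax G) - laplacian G).PosSemidef := by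
    rw [Matrix.posSemidef_iff_isHermitian_and_spectrum_nonneg]
    refine ⟨?_, ?_⟩
    · refine Matrix.IsHermitian.sub ?_ (laplacian_isHermitian G)
      rw [Matrix.algebraMap_eq_diagonal]
      exact Matrix.isHermitian_diagonal _
    · rw [← spectrum.singleton_sub_eq, (laplacian_isHermitian G).spectrum_real_eq_range_eigenvalues]
      rintro a ⟨b, hb, c, ⟨i, rfl⟩, rfl⟩
      rw [mem_singleton_iff.1 hb]
      simpa using le_psiMax G i
  have := hpsd.dotProduct_mulVec_nonneg u
  rw [Matrix.sub_mulVec, dotProduct_sub, sub_nonneg, Algebra.algebraMap_eq_smul_one, Matrix.smul_mulVec,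
    Matrix.one_mulVec, dotProduct_smul] at this
  simp only [star_trivial, dotProduct, Matrix.mulVec, smul_eq_mul] at this
  calc _ = ∑ i, u i * ∑ j, laplacian G i j * u j := Finset.sum_congr rfl fun i _ => mul_comm _ _
    _ ≤ _ := this
    _ = _ := by simp only [sq]

theorem sum_inner_laplacian_le (G : SimpleGraph (Fin N)) (x : Fin N → Vec n) :
    ∑ i, inner ℝ (∑ j, laplacian G i j • x j) (x i) ≤ psiMax G * ∑ i, ‖x i‖ ^ 2 := by
  calc ∑ i, inner ℝ (∑ j, laplacian G i j • x j) (x i)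
      = ∑ r, ∑ i, (∑ j, laplacian G i j * x j r) * x i r := by
        rw [Finset.sum_comm]
        refine Finset.sum_congr rfl fun i _ => ?_
        simp [PiLp.inner_apply, mul_comm]
    _ ≤ ∑ r, psiMax G * ∑ i, x i r ^ 2 :=
        Finset.sum_le_sum fun r _ => dotProduct_laplacian_le G fun i => x i r
    _ = _ := by
        rw [← Finset.mul_sum, Finset.sum_comm]
        simp [EuclideanSpace.norm_sq_eq]

open Classical in
theorem dMin_pos {G : SimpleGraph (Fin N)} (hN : 2 ≤ N) (hG : G.Connected) : 0 < dMin G := by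
  have : Nontrivial (Fin N) := Fin.nontrivial_iff_two_le.2 hN
  exact hG.preconnected.minDegree_pos_of_nontrivial

open Classical in
theorem psiMax_pos {G : SimpleGraph (Fin N)} (hN : 2 ≤ N) (hG : G.Connected) : 0 < psiMax G := by
  have : Nontrivial (Fin N) := Fin.nontrivial_iff_two_le.2 hN
  let i : Fin N := ⟨0, by omega⟩
  -- At a unit vector the quadratic form of the Laplacian is the degree, which is positive.
  have h := dotProduct_laplacian_le G (Pi.single i 1)
  have hd : 0 < G.degree i := hG.preconnected.degree_pos_of_nontrivial i
  simp [Pi.single_apply, laplacian_apply] at h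
  exact lt_of_lt_of_le (by exact_mod_cast hd) h

variable {G : SimpleGraph (Fin N)} {m : ℕ} {A : Profile N n →L[ℝ] EuclideanSpace ℝ (Fin m)}

/-- The profile in which all nodes take the decision `z`. -/
noncomputable def consensus (N : ℕ) (z : Vec n) : Profile N n := WithLp.toLp 2 fun _ => z

namespace IsConsensusMap

theorem inner_map (hA : IsConsensusMap G A) (x y : Profile N n) :
    inner ℝ (A x) (A y) = ∑ i, inner ℝ (∑ j, laplacian G i j • x j) (y i) := by
  rw [← ContinuousLinearMap.adjoint_inner_left, PiLp.inner_apply]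
  simp only [hA x]

open Classical in
theorem norm_sq_map (hA : IsConsensusMap G A) (x : Profile N n) :
    ‖A x‖ ^ 2 = 1 / 2 * ∑ i, ∑ j, if G.Adj i j then ‖x i - x j‖ ^ 2 else 0 := by
  rw [← real_inner_self_eq_norm_sq, hA.inner_map, sum_inner_laplacian]
  simp only [real_inner_self_eq_norm_sq]

theorem norm_sq_map_le (hA : IsConsensusMap G A) (x : Profile N n) :
    ‖A x‖ ^ 2 ≤ psiMax G * ∑ i, ‖x i‖ ^ 2 := by
  rw [← real_inner_self_eq_norm_sq, hA.inner_map]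
  exact sum_inner_laplacian_le G _

theorem map_consensus (hA : IsConsensusMap G A) (z : Vec n) : A (consensus N z) = 0 := by
  have := hA.norm_sq_map (consensus N z)
  simpa [consensus] using this

theorem norm_sub_le_of_adj (hA : IsConsensusMap G A) (x : Profile N n) {i j : Fin N}
    (hij : G.Adj i j) : ‖x i - x j‖ ≤ ‖A x‖ := by
  classical
  refine le_of_sq_le_sq ?_ (norm_nonneg _)
  rw [hA.norm_sq_map]
  let f : Fin N → Fin N → ℝ := fun k l => if G.Adj k l then ‖x k - x l‖ ^ 2 else 0
  have hf : ∀ k l, 0 ≤ f k l := fun k l => by simp only [f]; split_ifs <;> positivity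
  have h1 : f i j ≤ ∑ l, f i l :=
    Finset.single_le_sum (fun l _ => hf i l) (Finset.mem_univ j)
  have h2 : f j i ≤ ∑ l, f j l :=
    Finset.single_le_sum (fun l _ => hf j l) (Finset.mem_univ i)
  have h3 : ∑ l, f i l + ∑ l, f j l ≤ ∑ k, ∑ l, f k l := by
    rw [← Finset.sum_pair (f := fun k => ∑ l, f k l) hij.ne]
    exact Finset.sum_le_sum_of_subset_of_nonneg (Finset.subset_univ _)
      fun k _ _ => Finset.sum_nonneg fun l _ => hf k l
  have h4 : f i j = ‖x i - x j‖ ^ 2 := if_pos hij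
  have h5 : f j i = ‖x i - x j‖ ^ 2 := by rw [norm_sub_rev]; exact if_pos hij.symm
  simp only [f] at *
  linarith

/-- Triangle inequality along a path, which has fewer than `N` edges. -/
theorem norm_sub_le (hA : IsConsensusMap G A) (hG : G.Connected) (x : Profile N n) (i j : Fin N) :
    ‖x i - x j‖ ≤ N * ‖A x‖ := by
  have key : ∀ {k l : Fin N} (w : G.Walk k l), ‖x k - x l‖ ≤ w.length * ‖A x‖ := by
    intro k l w
    induction w with
    | nil => simp
    | @cons u v t h p ih =>
      have h1 := hA.norm_sub_le_of_adj x h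
      have h2 := norm_sub_le_norm_sub_add_norm_sub (x u) (x v) (x t)
      simp only [SimpleGraph.Walk.length_cons]
      push_cast
      linarith
  obtain ⟨p, hp⟩ := (hG i j).exists_isPath
  have hlt := hp.length_lt
  rw [Fintype.card_fin] at hlt
  refine (key p).trans (mul_le_mul_of_nonneg_right ?_ (norm_nonneg _))
  exact_mod_cast hlt.le

/-- On the range of a consensus map, the norm is controlled by the blocks of the adjoint image. -/
theorem norm_map_le_of_adjoint (hA : IsConsensusMap G A) (hG : G.Connected) (w : Profile N n)
    {U : Fin N → ℝ} (hU : ∀ i, ‖(ContinuousLinearMap.adjoint A (A w)) i‖ ≤ U i) :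
    ‖A w‖ ≤ N * ∑ i, U i := by
  obtain ⟨i₀⟩ := hG.nonempty
  -- Subtracting a consensus profile does not change `A w`, but now every block is at most `N ‖A
  -- w‖`. So `‖A w‖² = ⟨Aᵀ A w, w'⟩` is bounded linearly in `‖A w‖`.
  let w' : Profile N n := w - consensus N (w i₀)
  have hw' : A w' = A w := by simp [w', hA.map_consensus]
  have hU0 : ∀ i, 0 ≤ U i := fun i => (norm_nonneg _).trans (hU i)
  have hb : ∀ i, ‖w' i‖ ≤ N * ‖A w‖ := fun i => hA.norm_sub_le hG w i i₀
  have h1 : ‖A w‖ ^ 2 ≤ (N * ∑ i, U i) * ‖A w‖ := by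
    calc ‖A w‖ ^ 2 = inner ℝ (A w) (A w') := by rw [hw', real_inner_self_eq_norm_sq]
      _ = ∑ i, inner ℝ ((ContinuousLinearMap.adjoint A (A w)) i) (w' i) := by
          rw [← ContinuousLinearMap.adjoint_inner_left, PiLp.inner_apply]
      _ ≤ ∑ i, U i * (N * ‖A w‖) := Finset.sum_le_sum fun i _ =>
          (real_inner_le_norm _ _).trans
            (mul_le_mul (hU i) (hb i) (norm_nonneg _) (hU0 i))
      _ = _ := by rw [← Finset.sum_mul]; ring
  rcases (norm_nonneg (A w)).eq_or_lt with h | h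
  · rw [← h]
    exact mul_nonneg (Nat.cast_nonneg _) (Finset.sum_nonneg fun i _ => hU0 i)
  · rw [sq] at h1
    exact le_of_mul_le_mul_right h1 h

end IsConsensusMap

open Classical in
/-- The incidence map: the block of an ordered pair `(i, j)` is `(x_i - x_j) / √2` if `ij` is an
edge, and zero otherwise. -/
noncomputable def incidence (G : SimpleGraph (Fin N)) (n : ℕ) :
    Profile N n →ₗ[ℝ] PiLp 2 (fun _ : Fin N × Fin N => Vec n) where
  toFun x := WithLp.toLp 2 fun e =>
    if G.Adj e.1 e.2 then (√(1 / 2) : ℝ) • (x e.1 - x e.2) else 0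
  map_add' x y := by
    ext e : 1
    by_cases h : G.Adj e.1 e.2
    · simp only [h, if_true, PiLp.add_apply]; module
    · simp [h]
  map_smul' a x := by
    ext e : 1
    by_cases h : G.Adj e.1 e.2
    · simp only [h, if_true, PiLp.smul_apply, RingHom.id_apply]; module
    · simp [h]

theorem inner_incidence (G : SimpleGraph (Fin N)) (x y : Profile N n) :
    inner ℝ (incidence G n x) (incidence G n y) =
      ∑ i, inner ℝ (∑ j, laplacian G i j • x j) (y i) := by
  rw [sum_inner_laplacian, PiLp.inner_apply, Fintype.sum_prod_type, Finset.mul_sum]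
  refine Finset.sum_congr rfl fun i _ => ?_
  rw [Finset.mul_sum]
  refine Finset.sum_congr rfl fun j _ => ?_
  by_cases h : G.Adj i j
  · simp only [incidence, LinearMap.coe_mk, AddHom.coe_mk, h, if_true, inner_smul_left,
      inner_smul_right, conj_trivial]
    rw [← mul_assoc, Real.mul_self_sqrt (by norm_num)]
  · simp [incidence, h]

/-- Only the form `⟨A x, A y⟩` matters, so an orthonormal basis moves the codomain to a standard
Euclidean space. -/
theorem exists_euclidean_inner_eq {E W : Type*} [NormedAddCommGroup E] [InnerProductSpace ℝ E]
    [FiniteDimensional ℝ E] [NormedAddCommGroup W] [InnerProductSpace ℝ W] [FiniteDimensional ℝ W]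
    (T : E →ₗ[ℝ] W) : ∃ (m : ℕ) (A : E →L[ℝ] EuclideanSpace ℝ (Fin m)),
      ∀ x y, inner ℝ (A x) (A y) = inner ℝ (T x) (T y) :=
  ⟨_, (stdOrthonormalBasis ℝ W).repr.toLinearIsometry.toContinuousLinearMap.comp
    (LinearMap.toContinuousLinearMap T), fun x y =>
      (stdOrthonormalBasis ℝ W).repr.inner_map_map (T x) (T y)⟩

theorem exists_isConsensusMap (G : SimpleGraph (Fin N)) (n : ℕ) :
    ∃ (m : ℕ) (A : Profile N n →L[ℝ] EuclideanSpace ℝ (Fin m)), IsConsensusMap G A := by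
  obtain ⟨m, A, hA⟩ := exists_euclidean_inner_eq (incidence G n)
  have hin : ∀ x y, inner ℝ (A x) (A y) = ∑ i, inner ℝ (∑ j, laplacian G i j • x j) (y i) :=
    fun x y => (hA x y).trans (inner_incidence G x y)
  refine ⟨m, A, fun x i => ?_⟩
  have : ContinuousLinearMap.adjoint A (A x) =
      (WithLp.toLp 2 fun i => ∑ j, laplacian G i j • x j : Profile N n) := by
    refine ext_inner_right ℝ fun y => ?_
    rw [ContinuousLinearMap.adjoint_inner_left, hin, PiLp.inner_apply]
  rw [this]

end Graph

/-! ### The subproblem and its inexact minimizers -/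

section Subproblem

variable {N n m : ℕ} {P : Costs N n} {L : Fin N → ℝ≥0} {B τ : Fin N → ℝ}
  {G : SimpleGraph (Fin N)} {A : Profile N n →L[ℝ] EuclideanSpace ℝ (Fin m)}
  {lam alpha xi : ℝ} {θ : EuclideanSpace ℝ (Fin m)}

/-- The gradient of the smooth part of the subproblem. -/
noncomputable def smoothGrad (P : Costs N n) (A : Profile N n →L[ℝ] EuclideanSpace ℝ (Fin m))
    (lam : ℝ) (θ : EuclideanSpace ℝ (Fin m)) (x : Profile N n) : Profile N n :=
  WithLp.toLp 2 fun i => lam • gradient (P.gamma i) (x i) +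
    (ContinuousLinearMap.adjoint A (A x - lam • θ)) i

theorem sum_inner_smoothGrad (x d : Profile N n) :
    ∑ i, inner ℝ (smoothGrad P A lam θ x i) (d i) =
      lam * ∑ i, inner ℝ (gradient (P.gamma i) (x i)) (d i) +
        inner ℝ (A x - lam • θ) (A d) := by
  rw [← ContinuousLinearMap.adjoint_inner_left, PiLp.inner_apply, Finset.mul_sum,
    ← Finset.sum_add_distrib]
  refine Finset.sum_congr rfl fun i _ => ?_
  simp only [smoothGrad]
  rw [inner_add_left, inner_smul_left]
  simp

theorem gradient_smoothPart (hγ : ∀ i, InGamma (P.gamma i) (L i)) (x : Profile N n) :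
    gradient (smoothPart P A 0 lam θ) x = smoothGrad P A lam θ x := by
  refine HasGradientAt.gradient ?_
  rw [hasGradientAt_iff_hasFDerivAt]
  have h1 : ∀ i, HasFDerivAt (fun y : Profile N n => P.gamma i (y i))
      ((fderiv ℝ (P.gamma i) (x i)).comp (PiLp.proj 2 (fun _ : Fin N => Vec n) i)) x := fun i =>
    ((hγ i).differentiable (x i)).hasFDerivAt.comp x
      (PiLp.proj (𝕜 := ℝ) 2 (fun _ : Fin N => Vec n) i).hasFDerivAt
  have h2 : HasFDerivAt (fun y : Profile N n => A y - 0 - lam • θ) A x := by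
    simpa using (A.hasFDerivAt (x := x)).sub_const (lam • θ)
  have h3 := ((HasFDerivAt.fun_sum (u := Finset.univ) fun i _ => h1 i).const_mul lam).add
    ((h2.norm_sq).const_mul (1 / 2))
  refine h3.congr_fderiv ?_
  ext d
  have h4 : inner ℝ (smoothGrad P A lam θ x) d =
      ∑ i, inner ℝ (smoothGrad P A lam θ x i) (d i) := PiLp.inner_apply _ _
  rw [InnerProductSpace.toDual_apply_apply, h4, sum_inner_smoothGrad]
  simp [inner_gradient_left, inner_sub_left, inner_smul_left]

theorem half_norm_sq_map_sub (x z : Profile N n) (b : EuclideanSpace ℝ (Fin m)) :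
    1 / 2 * ‖A z - b‖ ^ 2 = 1 / 2 * ‖A x - b‖ ^ 2 + inner ℝ (A x - b) (A (z - x)) +
      1 / 2 * ‖A (z - x)‖ ^ 2 := by
  have : A z - b = (A x - b) + A (z - x) := by rw [map_sub]; abel
  rw [this, norm_add_sq_real]
  ring

theorem smoothPart_ge (hγ : ∀ i, InGamma (P.gamma i) (L i)) (hlam : 0 ≤ lam) (x z : Profile N n) :
    smoothPart P A 0 lam θ x + ∑ i, inner ℝ (smoothGrad P A lam θ x i) (z i - x i) ≤
      smoothPart P A 0 lam θ z := by
  have h1 := sum_inner_smoothGrad (P := P) (A := A) (lam := lam) (θ := θ) x (z - x)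
  simp only [PiLp.sub_apply] at h1
  rw [h1]
  simp only [smoothPart, sub_zero]
  rw [half_norm_sq_map_sub x z]
  have h2 : lam * ∑ i, (P.gamma i (x i) + inner ℝ (gradient (P.gamma i) (x i)) (z i - x i)) ≤
      lam * ∑ i, P.gamma i (z i) := mul_le_mul_of_nonneg_left
    (Finset.sum_le_sum fun i _ => (hγ i).gradient_inequality (x i) (z i)) hlam
  rw [Finset.sum_add_distrib] at h2
  nlinarith [sq_nonneg ‖A (z - x)‖]

/-- Descent inequality for each `γ_i`, plus `‖A d‖² ≤ ψ_max ∑ ‖d_i‖²`. The resulting block weights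
are the `L_i` of the proximal steps. -/
theorem smoothPart_le (hγ : ∀ i, InGamma (P.gamma i) (L i)) (hA : IsConsensusMap G A)
    (hlam : 0 ≤ lam) (x z : Profile N n) :
    smoothPart P A 0 lam θ z ≤ smoothPart P A 0 lam θ x +
      ∑ i, inner ℝ (smoothGrad P A lam θ x i) (z i - x i) +
      1 / 2 * ∑ i, (lam * L i + psiMax G) * ‖z i - x i‖ ^ 2 := by
  have h1 := sum_inner_smoothGrad (P := P) (A := A) (lam := lam) (θ := θ) x (z - x)
  simp only [PiLp.sub_apply] at h1
  rw [h1]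
  simp only [smoothPart, sub_zero]
  rw [half_norm_sq_map_sub x z]
  have h2 : lam * ∑ i, P.gamma i (z i) ≤
      lam * ∑ i, (P.gamma i (x i) + inner ℝ (gradient (P.gamma i) (x i)) (z i - x i) +
        L i / 2 * ‖z i - x i‖ ^ 2) := by
    refine mul_le_mul_of_nonneg_left (Finset.sum_le_sum fun i _ => ?_) hlam
    have := (hγ i).descent (x i) (z i - x i)
    rwa [add_sub_cancel] at this
  have h3 := hA.norm_sq_map_le (z - x)
  simp only [PiLp.sub_apply] at h3
  have h4 : 1 / 2 * ∑ i, (lam * L i + psiMax G) * ‖z i - x i‖ ^ 2 =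
      lam * ∑ i, L i / 2 * ‖z i - x i‖ ^ 2 + 1 / 2 * (psiMax G * ∑ i, ‖z i - x i‖ ^ 2) := by
    simp only [Finset.mul_sum, ← Finset.sum_add_distrib]
    exact Finset.sum_congr rfl fun i _ => by ring
  rw [Finset.sum_add_distrib, Finset.sum_add_distrib] at h2
  rw [h4]
  linarith

theorem _root_.PiLp.norm_le_sum_norm (x : Profile N n) : ‖x‖ ≤ ∑ i, ‖x i‖ := by
  refine le_of_sq_le_sq ?_ (Finset.sum_nonneg fun i _ => norm_nonneg _)
  rw [PiLp.norm_sq_eq_of_L2]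
  exact Finset.sum_sq_le_sq_sum_of_nonneg fun i _ => norm_nonneg _

theorem exists_isMin_subproblem (hγ : ∀ i, InGamma (P.gamma i) (L i))
    (hρ : ∀ i, InR (P.rho i) (B i) (τ i)) {s : ℝ} (hs0 : 0 < s) (hs : ∀ i, s < τ i)
    (hlam : 0 < lam) :
    ∃ xs, ∀ z, subproblem P A 0 lam θ xs ≤ subproblem P A 0 lam θ z := by
  choose M hM using fun i => (hγ i).bounded_below
  have hM' : ∀ i x, M i ≤ P.gamma i x := fun i x => hM i (mem_range_self x)
  refine exists_forall_le_of_norm_le (c := lam * s) (M := -(lam * ∑ i, M i)) ?_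
    (mul_pos hlam hs0) fun x => ?_
  · have h1 : ∀ i, Continuous (P.rho i) := fun i => (hρ i).convex.continuous_of_univ
    have h2 : ∀ i, Continuous (P.gamma i) := fun i => (hγ i).differentiable.continuous
    unfold subproblem smoothPart
    fun_prop
  · have h1 : s * ‖x‖ ≤ ∑ i, P.rho i (x i) := by
      refine (mul_le_mul_of_nonneg_left (PiLp.norm_le_sum_norm x) hs0.le).trans ?_
      rw [Finset.mul_sum]
      exact Finset.sum_le_sum fun i _ =>
        (mul_le_mul_of_nonneg_right (hs i).le (norm_nonneg _)).trans ((hρ i).coercive _)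
    have h2 : ∑ i, M i ≤ ∑ i, P.gamma i (x i) := Finset.sum_le_sum fun i _ => hM' i _
    have h3 := mul_le_mul_of_nonneg_left h1 hlam.le
    have h4 := mul_le_mul_of_nonneg_left h2 hlam.le
    unfold subproblem smoothPart
    nlinarith [sq_nonneg ‖A x - 0 - lam • θ‖]

/-- One inequality serving both stopping rules: under (a) it is immediate, under (b) it is convexity
with Cauchy–Schwarz. -/
theorem subproblem_le_of_inexact (hγ : ∀ i, InGamma (P.gamma i) (L i)) (hlam : 0 ≤ lam)
    (halpha : 0 ≤ alpha) (hxi : 0 ≤ xi) {x : Profile N n}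
    (hx : InexactA P A 0 lam alpha θ x ∨ InexactB P A 0 lam xi θ x) (z : Profile N n) :
    subproblem P A 0 lam θ x ≤ subproblem P A 0 lam θ z + alpha +
      xi / √(N : ℝ) * ∑ i, ‖x i - z i‖ := by
  have h0 : 0 ≤ xi / √(N : ℝ) := by positivity
  rcases hx with ⟨xs, hmin, hle⟩ | hx
  · have h1 : 0 ≤ xi / √(N : ℝ) * ∑ i, ‖x i - z i‖ :=
      mul_nonneg h0 (Finset.sum_nonneg fun i _ => norm_nonneg _)
    linarith [hmin z]
  · choose v hv hle using hx
    rw [gradient_smoothPart hγ] at hle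
    have h1 : lam * ∑ i, (P.rho i (x i) + inner ℝ (v i) (z i - x i)) ≤ lam * ∑ i, P.rho i (z i) :=
      mul_le_mul_of_nonneg_left (Finset.sum_le_sum fun i _ => hv i (z i)) hlam
    have h2 := smoothPart_ge (A := A) (θ := θ) hγ hlam x z
    have h3 : -(xi / √(N : ℝ) * ∑ i, ‖x i - z i‖) ≤
        ∑ i, inner ℝ (lam • v i + smoothGrad P A lam θ x i) (z i - x i) := by
      rw [Finset.mul_sum, ← Finset.sum_neg_distrib]
      refine Finset.sum_le_sum fun i _ => ?_
      have h4 := neg_le_of_abs_le (abs_real_inner_le_norm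
        (lam • v i + smoothGrad P A lam θ x i) (z i - x i))
      have h5 := mul_le_mul_of_nonneg_right (hle i) (norm_nonneg (z i - x i))
      rw [norm_sub_rev (x i)]
      linarith
    simp only [inner_add_left, inner_smul_left, Finset.sum_add_distrib, conj_trivial,
      ← Finset.mul_sum] at h3
    rw [Finset.sum_add_distrib] at h1
    unfold subproblem
    linarith

/-- Under (b) this is the triangle inequality. Under (a), no move of the single block `i` can lower
the objective by more than `alpha`, while the quadratic upper model predicts a decrease of `(‖g‖ -
lam * B i)² / (2ℓ)`. -/
theorem norm_smoothGrad_le (hγ : ∀ i, InGamma (P.gamma i) (L i))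
    (hρ : ∀ i, InR (P.rho i) (B i) (τ i)) (hA : IsConsensusMap G A) (hψ : 0 < psiMax G)
    (hlam : 0 ≤ lam) (hxi : 0 ≤ xi) {x : Profile N n}
    (hx : InexactA P A 0 lam alpha θ x ∨ InexactB P A 0 lam xi θ x) (i : Fin N) :
    ‖smoothGrad P A lam θ x i‖ ≤
      lam * B i + √(2 * (lam * L i + psiMax G) * alpha) + xi / √(N : ℝ) := by
  set g := smoothGrad P A lam θ x i with hg
  have hxi' : 0 ≤ xi / √(N : ℝ) := by positivity
  rcases hx with ⟨xs, hmin, hle⟩ | hx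
  · have hL : 0 < lam * L i + psiMax G := by positivity
    set ℓ := lam * L i + psiMax G
    have key : ∀ d : Vec n, 0 ≤ alpha + lam * (B i * ‖d‖) + inner ℝ g d + 1 / 2 * (ℓ * ‖d‖ ^ 2) := by
      intro d
      let z : Profile N n := x + PiLp.single 2 i d
      have hzi : ∀ j, z j - x j = if j = i then d else 0 := by
        intro j
        by_cases h : j = i
        · subst h; simp [z]
        · simp [z, h]
      have h1 := smoothPart_le (θ := θ) hγ hA hlam x z
      have h2 : ∑ j, inner ℝ (smoothGrad P A lam θ x j) (z j - x j) = inner ℝ g d := by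
        simp only [hzi, hg]
        rw [Finset.sum_eq_single i (fun j _ hj => by simp [hj]) (by simp), if_pos rfl]
      have h3 : ∑ j, (lam * L j + psiMax G) * ‖z j - x j‖ ^ 2 = ℓ * ‖d‖ ^ 2 := by
        simp only [hzi]
        rw [Finset.sum_eq_single i (fun j _ hj => by simp [hj]) (by simp), if_pos rfl]
      have h4 : ∑ j, P.rho j (z j) - ∑ j, P.rho j (x j) ≤ B i * ‖d‖ := by
        rw [← Finset.sum_sub_distrib]
        calc _ ≤ ∑ j, B j * ‖z j - x j‖ := Finset.sum_le_sum fun j _ => (hρ j).sub_le _ _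
          _ = _ := by
            simp only [hzi]
            rw [Finset.sum_eq_single i (fun j _ hj => by simp [hj]) (by simp), if_pos rfl]
      have h5 := mul_le_mul_of_nonneg_left h4 hlam
      have h6 := hmin z
      rw [h2, h3] at h1
      unfold subproblem at h6 hle
      linarith
    by_contra! hcon
    have hs := Real.sqrt_nonneg (2 * ℓ * alpha)
    have hB := mul_nonneg hlam (hρ i).B_pos.le
    -- The step length along `-g` that minimizes the quadratic model in `key`.
    set r := (‖g‖ - lam * B i) / ℓ with hr
    have hr1 : r * ℓ = ‖g‖ - lam * B i := div_mul_cancel₀ _ hL.ne'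
    have hgpos : 0 < ‖g‖ := by linarith
    have hr0 : 0 ≤ r := div_nonneg (by linarith) hL.le
    have := key (-(r / ‖g‖) • g)
    rw [norm_smul, inner_smul_right, real_inner_self_eq_norm_sq, norm_neg, Real.norm_eq_abs,
      abs_of_nonneg (div_nonneg hr0 hgpos.le), div_mul_cancel₀ _ hgpos.ne'] at this
    have h7 : -(r / ‖g‖) * ‖g‖ ^ 2 = -(r * ‖g‖) := by field_simp
    rw [h7] at this
    have h8 : (r * ℓ) ^ 2 ≤ 2 * ℓ * alpha := by
      have : r * (r * ℓ) ≤ 2 * alpha := by nlinarith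
      nlinarith
    have h9 := Real.le_sqrt_of_sq_le h8
    linarith
  · obtain ⟨v, hv, hle⟩ := hx i
    rw [gradient_smoothPart hγ, ← hg] at hle
    have h1 := (hρ i).subgradient_bound _ v hv
    have h2 : ‖g‖ ≤ ‖lam • v + g‖ + ‖lam • v‖ := by
      simpa [add_comm] using norm_sub_le (lam • v + g) (lam • v)
    rw [norm_smul, Real.norm_eq_abs, abs_of_nonneg hlam] at h2
    have h3 := mul_le_mul_of_nonneg_left h1 hlam
    have h4 := Real.sqrt_nonneg (2 * (lam * L i + psiMax G) * alpha)
    linarith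

end Subproblem

/-! ### Uniform bounds and the O(λ) error estimate -/

section Bounds

variable {N n : ℕ} {P : Costs N n} {L : Fin N → ℝ≥0} {B τ : Fin N → ℝ} {G : SimpleGraph (Fin N)}

theorem isLeast_optVal (hN : 0 < N) (hγ : ∀ i, InGamma (P.gamma i) (L i))
    (hρ : ∀ i, InR (P.rho i) (B i) (τ i)) : IsLeast (range P.central) P.optVal := by
  choose M hM using fun i => (hγ i).bounded_below
  have hM' : ∀ i x, M i ≤ P.gamma i x := fun i x => hM i (mem_range_self x)
  have hcont : Continuous P.central := by
    have h1 : ∀ i, Continuous (P.rho i) := fun i => (hρ i).convex.continuous_of_univ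
    have h2 : ∀ i, Continuous (P.gamma i) := fun i => (hγ i).differentiable.continuous
    unfold Costs.central
    fun_prop
  have : Nonempty (Fin N) := ⟨⟨0, hN⟩⟩
  obtain ⟨z, hz⟩ := exists_forall_le_of_norm_le (c := ∑ i, τ i) (M := -∑ i, M i) hcont
    (Finset.sum_pos (fun i _ => (hρ i).tau_pos) Finset.univ_nonempty) fun x => by
      rw [Finset.sum_mul, sub_neg_eq_add, ← Finset.sum_add_distrib]
      exact Finset.sum_le_sum fun i _ => add_le_add ((hρ i).coercive x) (hM' i x)
  have h : IsLeast (range P.central) (P.central z) :=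
    ⟨mem_range_self z, forall_mem_range.2 hz⟩
  have h2 : P.optVal = P.central z := h.csInf_eq
  rwa [h2]

/-- Compare with the consensus profile at `z`, which `A` kills, and divide by `lam`. The penalty at
`x` becomes the squared norm of the next multiplier, as `A x - lam • θ` is `-lam` times it. -/
theorem total_add_le (hγ : ∀ i, InGamma (P.gamma i) (L i)) {m : ℕ}
    {A : Profile N n →L[ℝ] EuclideanSpace ℝ (Fin m)} (hA : IsConsensusMap G A)
    {lam alpha xi : ℝ} {θ : EuclideanSpace ℝ (Fin m)} {x : Profile N n}
    (hlam : 0 < lam) (halpha : 0 ≤ alpha) (hxi : 0 ≤ xi)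
    (hx : InexactA P A 0 lam alpha θ x ∨ InexactB P A 0 lam xi θ x) (z : Vec n) :
    P.total x + lam / 2 * ‖θ - (1 / lam) • A x‖ ^ 2 ≤
      P.central z + lam / 2 * ‖θ‖ ^ 2 + alpha / lam + xi / lam / √(N : ℝ) * ∑ i, ‖x i - z‖ := by
  have h := subproblem_le_of_inexact hγ hlam.le halpha hxi hx (consensus N z)
  have h1 : ‖A x - lam • θ‖ ^ 2 = lam ^ 2 * ‖θ - (1 / lam) • A x‖ ^ 2 := by
    have : A x - lam • θ = (-lam) • (θ - (1 / lam) • A x) := by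
      rw [smul_sub, smul_smul]
      have : -lam * (1 / lam) = -1 := by field_simp
      rw [this]
      module
    rw [this, norm_smul, mul_pow, Real.norm_eq_abs, sq_abs, neg_sq]
  have h2 : ‖lam • θ‖ ^ 2 = lam ^ 2 * ‖θ‖ ^ 2 := by
    rw [norm_smul, mul_pow, Real.norm_eq_abs, sq_abs]
  simp only [subproblem, smoothPart, sub_zero, hA.map_consensus, zero_sub, norm_neg, h1,
    h2] at h
  simp only [consensus] at h
  have h3 : lam * (P.total x + lam / 2 * ‖θ - (1 / lam) • A x‖ ^ 2) ≤
      lam * (P.central z + lam / 2 * ‖θ‖ ^ 2 + alpha / lam +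
        xi / lam / √(N : ℝ) * ∑ i, ‖x i - z‖) := by
    have e1 : lam * (alpha / lam) = alpha := mul_div_cancel₀ _ hlam.ne'
    have e2 : lam * (xi / lam / √(N : ℝ) * ∑ i, ‖x i - z‖) =
        xi / √(N : ℝ) * ∑ i, ‖x i - z‖ := by
      field_simp
    rw [mul_add lam (_ + _), mul_add lam (_ + _), e1, e2]
    unfold Costs.total Costs.central
    simp only [Finset.sum_add_distrib]
    linarith
  exact le_of_mul_le_mul_left h3 hlam

theorem InGamma.norm_gradient_le {γ : Vec n → ℝ} {ℓ : ℝ≥0} (h : InGamma γ ℓ) {x : Vec n} {X : ℝ}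
    (hx : ‖x‖ ≤ X) : ‖gradient γ x‖ ≤ ‖gradient γ 0‖ + ℓ * X := by
  have h1 := h.lipschitz.norm_sub_le x 0
  rw [sub_zero] at h1
  have h2 := norm_le_norm_add_norm_sub' (gradient γ x) (gradient γ 0)
  have h3 := mul_le_mul_of_nonneg_left hx ℓ.coe_nonneg
  linarith

/-- One step of the scheme keeps the multiplier in a fixed ball, and its primal iterate lies in a
fixed ball, as soon as `lam` is small. -/
def StepBounds (P : Costs N n) (G : SimpleGraph (Fin N)) (a s X T Λ : ℝ) : Prop :=
  ∀ (m : ℕ) (A : Profile N n →L[ℝ] EuclideanSpace ℝ (Fin m)), IsConsensusMap G A →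
    ∀ (lam alpha xi : ℝ) (w x : Profile N n), 0 < lam → lam ≤ Λ →
      0 ≤ alpha → alpha ≤ a * lam ^ 2 → 0 ≤ xi → xi ≤ s * lam → ‖A w‖ ≤ T →
      (InexactA P A 0 lam alpha (A w) x ∨ InexactB P A 0 lam xi (A w) x) →
      (∀ i, ‖x i‖ ≤ X) ∧ ‖A w - (1 / lam) • A x‖ ≤ T

/-- The order of choices avoids circularity: `X` comes from comparison with 0, `T` depends on `X`,
and `Λ` is chosen last so that the multiplier term `lam * T² / 2` in the bound behind `X` is below
1. -/
theorem exists_stepBounds (hN : 2 ≤ N) (hG : G.Connected) (hγ : ∀ i, InGamma (P.gamma i) (L i))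
    (hρ : ∀ i, InR (P.rho i) (B i) (τ i)) {a s : ℝ} (ha : 0 < a) (hs0 : 0 < s)
    (hs : ∀ i, s < τ i) :
    ∃ X T Λ : ℝ, 0 < X ∧ 0 ≤ T ∧ 0 < Λ ∧ StepBounds P G a s X T Λ := by
  choose M hM using fun i => (hγ i).bounded_below
  have hM' : ∀ i x, M i ≤ P.gamma i x := fun i x => hM i (mem_range_self x)
  have hsN : ∀ {u : ℝ}, 0 ≤ u → u / √(N : ℝ) ≤ u := fun hu =>
    div_le_self hu (Real.one_le_sqrt.2 (by exact_mod_cast (by omega : 1 ≤ N)))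
  have hψ := psiMax_pos hN hG
  -- The summand 1 absorbs the multiplier term and `a` absorbs `alpha / lam`. The error from rule
  -- (b) costs `s * ‖x i‖` per block, which leaves the growth rate `τ i - s`.
  obtain ⟨Q, hQ0, hQ⟩ : ∃ Q : ℝ, 0 ≤ Q ∧ P.central 0 + 1 + a - ∑ i, M i ≤ Q :=
    ⟨_, abs_nonneg _, le_abs_self _⟩
  set X : ℝ := 1 + ∑ i, Q / (τ i - s) with hX
  have hXi : ∀ i, Q / (τ i - s) ≤ X := fun i => by
    have := Finset.single_le_sum (f := fun i => Q / (τ i - s))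
      (fun i _ => div_nonneg hQ0 (sub_pos.2 (hs i)).le) (Finset.mem_univ i)
    linarith
  have hX0 : 0 < X := add_pos_of_pos_of_nonneg one_pos
    (Finset.sum_nonneg fun i _ => div_nonneg hQ0 (sub_pos.2 (hs i)).le)
  let U : Fin N → ℝ := fun i => ‖gradient (P.gamma i) 0‖ + L i * X +
    (B i + √(2 * (L i + psiMax G) * a) + s)
  have hU0 : ∀ i, 0 ≤ U i := fun i => by
    have := (hρ i).B_pos
    positivity
  set T : ℝ := N * ∑ i, U i with hT
  have hT0 : 0 ≤ T := mul_nonneg (Nat.cast_nonneg _) (Finset.sum_nonneg fun i _ => hU0 i)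
  refine ⟨X, T, 1 / (T ^ 2 + 1), hX0, hT0, by positivity, ?_⟩
  intro m A hA lam alpha xi w x hlam hlam1 halpha0 halpha hxi0 hxi hw hx
  rw [le_div_iff₀ (by positivity)] at hlam1
  have hlamT : lam * T ^ 2 ≤ 1 := by nlinarith
  have hlam2 : lam ≤ 1 := by nlinarith [sq_nonneg T]
  have hxi1 : xi / lam / √(N : ℝ) ≤ s :=
    (hsN (by positivity)).trans ((div_le_iff₀ hlam).2 hxi)
  have hal1 : alpha / lam ≤ a := by
    rw [div_le_iff₀ hlam]
    nlinarith [mul_pos ha hlam]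
  have h1 : ∀ i, ‖x i‖ ≤ X := by
    have h2 := total_add_le hγ hA hlam halpha0 hxi0 hx 0
    have h3 : ∑ i, ((τ i - s) * ‖x i‖ + s * ‖x i‖ + M i) ≤ P.total x :=
      Finset.sum_le_sum fun i _ => by nlinarith [(hρ i).coercive (x i), hM' i (x i)]
    have h4 : xi / lam / √(N : ℝ) * ∑ i, ‖x i - 0‖ ≤ s * ∑ i, ‖x i‖ := by
      simp only [sub_zero]
      exact mul_le_mul_of_nonneg_right hxi1 (Finset.sum_nonneg fun i _ => norm_nonneg _)
    have h5 : ‖A w‖ ^ 2 ≤ T ^ 2 := pow_le_pow_left₀ (norm_nonneg _) hw 2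
    have h6 : 0 ≤ lam / 2 * ‖A w - (1 / lam) • A x‖ ^ 2 := by positivity
    rw [Finset.sum_add_distrib, Finset.sum_add_distrib, ← Finset.mul_sum] at h3
    intro i
    have h7 : (τ i - s) * ‖x i‖ ≤ ∑ i, (τ i - s) * ‖x i‖ :=
      Finset.single_le_sum (f := fun i => (τ i - s) * ‖x i‖)
        (fun i _ => mul_nonneg (sub_pos.2 (hs i)).le (norm_nonneg _)) (Finset.mem_univ i)
    refine le_trans ?_ (hXi i)
    rw [le_div_iff₀ (sub_pos.2 (hs i))]
    nlinarith
  refine ⟨h1, ?_⟩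
  have h2 : A w - (1 / lam) • A x = A (w - (1 / lam) • x) := by rw [map_sub, map_smul]
  rw [h2]
  refine hA.norm_map_le_of_adjoint hG _ fun i => ?_
  rw [← h2]
  have h3 := norm_smoothGrad_le hγ hρ hA hψ hlam.le hxi0 hx i
  -- The gradient of the smooth part is `lam` times (`∇γ_i` minus block `i` of `Aᵀθ⁺`), so a
  -- gradient of size O(`lam`) bounds `Aᵀθ⁺`.
  have h4 : (ContinuousLinearMap.adjoint A (A w - (1 / lam) • A x)) i =
      gradient (P.gamma i) (x i) - (1 / lam) • smoothGrad P A lam (A w) x i := by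
    have e : A x - lam • A w = (-lam) • (A w - (1 / lam) • A x) := by
      rw [smul_sub, smul_smul]
      have : -lam * (1 / lam) = -1 := by field_simp
      rw [this]
      module
    simp only [smoothGrad]
    rw [e, map_smul, PiLp.smul_apply, smul_add, smul_smul, smul_smul]
    have e1 : 1 / lam * lam = 1 := by field_simp
    have e2 : 1 / lam * -lam = -1 := by field_simp
    rw [e1, e2]
    module
  rw [h4]
  have h5 : ‖(1 / lam) • smoothGrad P A lam (A w) x i‖ ≤
      B i + √(2 * (L i + psiMax G) * a) + s := by
    rw [norm_smul, Real.norm_eq_abs, abs_of_pos (by positivity), one_div, inv_mul_le_iff₀ hlam]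
    have e1 : √(2 * (lam * L i + psiMax G) * alpha) ≤ lam * √(2 * (L i + psiMax G) * a) := by
      rw [← Real.sqrt_sq hlam.le, ← Real.sqrt_mul (sq_nonneg _), Real.sqrt_sq hlam.le]
      refine Real.sqrt_le_sqrt ?_
      have : lam * L i ≤ L i := mul_le_of_le_one_left (L i).coe_nonneg hlam2
      calc 2 * (lam * L i + psiMax G) * alpha
          ≤ 2 * (L i + psiMax G) * (a * lam ^ 2) := by gcongr
        _ = _ := by ring
    have e2 : xi / √(N : ℝ) ≤ lam * s := (hsN hxi0).trans (by linarith)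
    linarith
  exact (norm_sub_le _ _).trans (add_le_add ((hγ i).norm_gradient_le (h1 i)) h5)

/-- Boundedness only needs `xi ≤ s * lam`; an error of order `lam` needs `xi = O(lam²)`, hence the
extra constant `σ`. -/
theorem StepBounds.exists_rate (hN : 2 ≤ N) (hG : G.Connected)
    (hγ : ∀ i, InGamma (P.gamma i) (L i)) (hρ : ∀ i, InR (P.rho i) (B i) (τ i))
    {a s X T Λ σ : ℝ} (hX : 0 < X) (hT : 0 ≤ T) (ha : 0 < a) (hσ : 0 ≤ σ)
    (h : StepBounds P G a s X T Λ) :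
    ∃ D : ℝ, 0 < D ∧ ∀ (m : ℕ) (A : Profile N n →L[ℝ] EuclideanSpace ℝ (Fin m)),
      IsConsensusMap G A → ∀ (lam alpha xi : ℝ) (w x : Profile N n), 0 < lam → lam ≤ Λ →
      0 ≤ alpha → alpha ≤ a * lam ^ 2 → 0 ≤ xi → xi ≤ s * lam → xi ≤ σ * lam ^ 2 → ‖A w‖ ≤ T →
      (InexactA P A 0 lam alpha (A w) x ∨ InexactB P A 0 lam xi (A w) x) →
      IsEpsOptimal P (D * lam) x ∧ IsEpsFeasible G (D * lam) x := by
  obtain ⟨⟨z, hz⟩, hmin⟩ := isLeast_optVal (by omega) hγ hρ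
  have hsN : ∀ {u : ℝ}, 0 ≤ u → u / √(N : ℝ) ≤ u := fun hu =>
    div_le_self hu (Real.one_le_sqrt.2 (by exact_mod_cast (by omega : 1 ≤ N)))
  let i₀ : Fin N := ⟨0, by omega⟩
  set D₁ : ℝ := T ^ 2 / 2 + a + σ * ∑ _i : Fin N, (X + ‖z‖) with hD₁
  set D₂ : ℝ := ∑ i, (B i + (‖gradient (P.gamma i) 0‖ + L i * X)) * (N * (2 * T)) with hD₂
  have hD₁0 : 0 < D₁ := by positivity
  have hBi : ∀ i, 0 ≤ B i + (‖gradient (P.gamma i) 0‖ + L i * X) := fun i => by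
    have := (hρ i).B_pos
    positivity
  have hD₂0 : 0 ≤ D₂ := Finset.sum_nonneg fun i _ => mul_nonneg (hBi i) (by positivity)
  refine ⟨D₁ + D₂ + 2 * T, by positivity, ?_⟩
  intro m A hA lam alpha xi w x hlam hlam1 halpha0 halpha hxi0 hxi hxiσ hw hx
  obtain ⟨hxX, hθ⟩ := h m A hA lam alpha xi w x hlam hlam1 halpha0 halpha hxi0 hxi hw hx
  have hAx : ‖A x‖ ≤ 2 * T * lam := by
    have e : A x = lam • (A w - (A w - (1 / lam) • A x)) := by
      rw [sub_sub_cancel, smul_smul, mul_one_div_cancel hlam.ne', one_smul]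
    rw [e, norm_smul, Real.norm_eq_abs, abs_of_pos hlam]
    nlinarith [norm_sub_le (A w) (A w - (1 / lam) • A x)]
  have hup : P.total x ≤ P.optVal + D₁ * lam := by
    have h2 := total_add_le hγ hA hlam halpha0 hxi0 hx z
    have h3 : alpha / lam ≤ a * lam := by
      rw [div_le_iff₀ hlam]
      linarith
    have h4 : xi / lam / √(N : ℝ) ≤ σ * lam :=
      (hsN (by positivity)).trans ((div_le_iff₀ hlam).2 (by linarith))
    have h5 : xi / lam / √(N : ℝ) * ∑ i, ‖x i - z‖ ≤ σ * lam * ∑ _i : Fin N, (X + ‖z‖) :=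
      mul_le_mul h4 (Finset.sum_le_sum fun i _ =>
        (norm_sub_le _ _).trans (add_le_add_left (hxX i) _))
        (Finset.sum_nonneg fun i _ => norm_nonneg _) (by positivity)
    have h6 : ‖A w‖ ^ 2 ≤ T ^ 2 := pow_le_pow_left₀ (norm_nonneg _) hw 2
    have h7 : 0 ≤ lam / 2 * ‖A w - (1 / lam) • A x‖ ^ 2 := by positivity
    have h8 : lam / 2 * ‖A w‖ ^ 2 ≤ lam / 2 * T ^ 2 := by gcongr
    rw [hz] at h2
    rw [hD₁]
    linarith
  have hlow : P.optVal ≤ P.total x + D₂ * lam := by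
    have h2 : P.optVal ≤ P.central (x i₀) := hmin (mem_range_self _)
    have h3 : P.central (x i₀) - P.total x ≤ D₂ * lam := by
      unfold Costs.central Costs.total
      rw [← Finset.sum_sub_distrib, hD₂, Finset.sum_mul]
      refine Finset.sum_le_sum fun i _ => ?_
      have e1 := (hρ i).sub_le (x i₀) (x i)
      have e2 := (hγ i).gradient_inequality (x i₀) (x i)
      have e3 := neg_le_of_abs_le (abs_real_inner_le_norm (gradient (P.gamma i) (x i₀)) (x i - x i₀))
      have e4 := mul_le_mul_of_nonneg_right ((hγ i).norm_gradient_le (hxX i₀))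
        (norm_nonneg (x i - x i₀))
      have e5 : ‖x i - x i₀‖ ≤ N * (2 * T * lam) :=
        (hA.norm_sub_le hG x i i₀).trans (mul_le_mul_of_nonneg_left hAx (Nat.cast_nonneg _))
      have e6 := mul_le_mul_of_nonneg_left e5 (hBi i)
      rw [norm_sub_rev] at e1
      nlinarith
    linarith
  constructor
  · unfold IsEpsOptimal
    rw [abs_le]
    constructor <;> nlinarith [mul_nonneg hT hlam.le, mul_nonneg hD₂0 hlam.le,
      mul_nonneg hD₁0.le hlam.le]
  · intro i j hij
    refine (hA.norm_sub_le_of_adj x hij).trans (hAx.trans ?_)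
    exact mul_le_mul_of_nonneg_right (by linarith) hlam.le

end Bounds

/-! ### Convergence of the accelerated inner loop -/

section InnerLoop

variable {N n : ℕ}

namespace Input

variable {I : Input N n} {k m : ℕ} {B τ : Fin N → ℝ}
  {A : Profile N n →L[ℝ] EuclideanSpace ℝ (Fin m)} {θ : EuclideanSpace ℝ (Fin m)}

/-- The vector `xbar` stands in for the multiplier: since `A xbar = -lam θ`, the nodes obtain `Aᵀ(A
ybar - lam θ)` by applying the Laplacian to `ybar + xbar`. -/
theorem q_eq_smoothGrad (hA : IsConsensusMap I.G A) {xbar : Profile N n}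
    (hxbar : A xbar = -(I.params.lam k • θ)) (ybar : Profile N n) (i : Fin N) :
    I.q k xbar ybar i = smoothGrad I.costs A (I.params.lam k) θ ybar i := by
  have h : A ybar - I.params.lam k • θ = A (ybar + xbar) := by
    rw [map_add, hxbar, sub_eq_add_neg]
  simp only [q, smoothGrad]
  rw [h, hA, sum_closedNbhd I.G (fun j => ybar j + xbar j) i]
  simp only [PiLp.add_apply]

theorem inner_succ (S : OuterState N n) (ℓ : ℕ) :
    I.inner k S (ℓ + 1) = I.innerStep k S.xbar (I.inner k S ℓ) :=
  Function.iterate_succ_apply' _ _ _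

theorem Lk_pos (hlam : 0 ≤ I.params.lam k) (hψ : 0 < psiMax I.G) (i : Fin N) : 0 < I.Lk k i := by
  unfold Lk
  positivity

/-- The inequality behind the proximal gradient step. -/
theorem subproblem_innerStep_le (hγ : ∀ i, InGamma (I.costs.gamma i) (I.L i))
    (hρ : ∀ i, InR (I.costs.rho i) (B i) (τ i)) (hA : IsConsensusMap I.G A)
    (hψ : 0 < psiMax I.G) (hlam : 0 < I.params.lam k) {xbar : Profile N n}
    (hxbar : A xbar = -(I.params.lam k • θ)) (s : InnerState N n) (z : Profile N n) :
    subproblem I.costs A 0 (I.params.lam k) θ (I.innerStep k xbar s).y +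
        (∑ i, I.Lk k i * Inner.inner ℝ (s.ybar i - (I.innerStep k xbar s).y i)
          (z i - (I.innerStep k xbar s).y i) -
        1 / 2 * ∑ i, I.Lk k i * ‖(I.innerStep k xbar s).y i - s.ybar i‖ ^ 2) ≤
      subproblem I.costs A 0 (I.params.lam k) θ z := by
  set lam := I.params.lam k
  set y' := (I.innerStep k xbar s).y with hy'
  have hL := fun i => Lk_pos (I := I) hlam.le hψ i
  have hprox : ∀ i, IsProx (fun z => lam / I.Lk k i * I.costs.rho i z)
      (s.ybar i - (1 / I.Lk k i) • I.q k xbar s.ybar i) (y' i) := by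
    intro i
    refine isProx_prox ?_ ?_ _
    · exact continuous_const.mul (hρ i).convex.continuous_of_univ
    · exact fun x => mul_nonneg (div_nonneg hlam.le (hL i).le)
        ((mul_nonneg (hρ i).tau_pos.le (norm_nonneg x)).trans ((hρ i).coercive x))
  have h1 : ∀ i, lam * I.costs.rho i (y' i) + (I.Lk k i * Inner.inner ℝ (s.ybar i - y' i) (z i - y' i) -
      Inner.inner ℝ (I.q k xbar s.ybar i) (z i - y' i)) ≤ lam * I.costs.rho i (z i) := by
    intro i
    have hc : ConvexOn ℝ univ (fun z => lam / I.Lk k i * I.costs.rho i z) :=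
      (hρ i).convex.smul (div_nonneg hlam.le (hL i).le)
    have h2 := mul_le_mul_of_nonneg_left ((hprox i).le hc (z i)) (hL i).le
    have e : s.ybar i - (1 / I.Lk k i) • I.q k xbar s.ybar i - y' i =
        (s.ybar i - y' i) - (1 / I.Lk k i) • I.q k xbar s.ybar i := by abel
    rw [e, inner_sub_left, inner_smul_left, conj_trivial] at h2
    have hne := (hL i).ne'
    calc _ = I.Lk k i * (lam / I.Lk k i * I.costs.rho i (y' i) +
          (Inner.inner ℝ (s.ybar i - y' i) (z i - y' i) -
            1 / I.Lk k i * Inner.inner ℝ (I.q k xbar s.ybar i) (z i - y' i))) := by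
          field_simp
      _ ≤ _ := h2
      _ = _ := by field_simp
  have h2 := Finset.sum_le_sum fun i (_ : i ∈ Finset.univ) => h1 i
  have h3 := smoothPart_le (θ := θ) hγ hA hlam.le s.ybar y'
  have h4 := smoothPart_ge (A := A) (θ := θ) hγ hlam.le s.ybar z
  have h5 : ∑ i, Inner.inner ℝ (I.q k xbar s.ybar i) (z i - y' i) =
      ∑ i, Inner.inner ℝ (smoothGrad I.costs A lam θ s.ybar i) (z i - s.ybar i) -
        ∑ i, Inner.inner ℝ (smoothGrad I.costs A lam θ s.ybar i) (y' i - s.ybar i) := by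
    rw [← Finset.sum_sub_distrib]
    refine Finset.sum_congr rfl fun i _ => ?_
    rw [q_eq_smoothGrad hA hxbar, ← inner_sub_right]
    congr 1
    abel
  simp only [Finset.sum_add_distrib, Finset.sum_sub_distrib, ← Finset.mul_sum] at h2
  rw [h5] at h2
  have h6 : ∑ i, (lam * I.L i + psiMax I.G) * ‖y' i - s.ybar i‖ ^ 2 =
    ∑ i, I.Lk k i * ‖y' i - s.ybar i‖ ^ 2 := rfl
  unfold subproblem
  rw [h6] at h3
  linarith

theorem innerStep_t_ge (xbar : Profile N n) (s : InnerState N n) :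
    s.t + 1 / 2 ≤ (I.innerStep k xbar s).t := by
  have : 2 * s.t ≤ √(1 + 4 * s.t ^ 2) := Real.le_sqrt_of_sq_le (by nlinarith)
  simp only [innerStep]
  linarith

theorem innerStep_t_mul (xbar : Profile N n) (s : InnerState N n) :
    (I.innerStep k xbar s).t * ((I.innerStep k xbar s).t - 1) = s.t ^ 2 := by
  have : √(1 + 4 * s.t ^ 2) ^ 2 = 1 + 4 * s.t ^ 2 := Real.sq_sqrt (by positivity)
  simp only [innerStep]
  linarith

theorem inner_t_ge (S : OuterState N n) (ℓ : ℕ) : ((ℓ : ℝ) + 2) / 2 ≤ (I.inner k S ℓ).t := by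
  induction ℓ with
  | zero => simp [Input.inner]
  | succ ℓ ih =>
    rw [inner_succ]
    have := innerStep_t_ge (I := I) (k := k) S.xbar (I.inner k S ℓ)
    push_cast
    linarith

/-- The energy that the accelerated proximal gradient method decreases. -/
noncomputable def energy (I : Input N n) (k : ℕ)
    (A : Profile N n →L[ℝ] EuclideanSpace ℝ (Fin m)) (θ : EuclideanSpace ℝ (Fin m))
    (xs : Profile N n) (s : InnerState N n) : ℝ :=
  s.t * (s.t - 1) * (subproblem I.costs A 0 (I.params.lam k) θ s.y -
      subproblem I.costs A 0 (I.params.lam k) θ xs) +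
    1 / 2 * ∑ i, I.Lk k i * ‖s.t • s.ybar i - (s.t - 1) • s.y i - xs i‖ ^ 2

/-- The proximal inequality is used at `s.y` with weight `t(t-1)` and at `xs` with weight `t`. The
total weight `t²` equals `t'(t'-1)` for the next parameter `t'`, and the extrapolation is chosen so
that the quadratic terms telescope. -/
theorem energy_innerStep_le (hγ : ∀ i, InGamma (I.costs.gamma i) (I.L i))
    (hρ : ∀ i, InR (I.costs.rho i) (B i) (τ i)) (hA : IsConsensusMap I.G A)
    (hψ : 0 < psiMax I.G) (hlam : 0 < I.params.lam k) {xbar : Profile N n}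
    (hxbar : A xbar = -(I.params.lam k • θ)) (xs : Profile N n) {s : InnerState N n}
    (ht : 1 ≤ s.t) :
    I.energy k A θ xs (I.innerStep k xbar s) ≤ I.energy k A θ xs s := by
  have hkey := subproblem_innerStep_le hγ hρ hA hψ hlam hxbar s
  have ht' : 0 < (I.innerStep k xbar s).t := by
    have := innerStep_t_ge (I := I) (k := k) xbar s
    linarith
  have h1 := mul_le_mul_of_nonneg_left (hkey s.y)
    (mul_nonneg (zero_le_one.trans ht) (sub_nonneg.2 ht))
  have h2 := mul_le_mul_of_nonneg_left (hkey xs) (zero_le_one.trans ht)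
  have hybar : ∀ i, (I.innerStep k xbar s).t • (I.innerStep k xbar s).ybar i -
      ((I.innerStep k xbar s).t - 1) • (I.innerStep k xbar s).y i - xs i =
      s.t • (I.innerStep k xbar s).y i - (s.t - 1) • s.y i - xs i := by
    intro i
    have e : (I.innerStep k xbar s).ybar i = (I.innerStep k xbar s).y i +
        ((s.t - 1) / (I.innerStep k xbar s).t) • ((I.innerStep k xbar s).y i - s.y i) := rfl
    rw [e, smul_add, smul_smul, mul_div_cancel₀ _ ht'.ne']
    module
  unfold energy
  rw [innerStep_t_mul]
  simp only [hybar]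
  set y' := (I.innerStep k xbar s).y
  have h3 : s.t * (s.t - 1) * (∑ i, I.Lk k i * Inner.inner ℝ (s.ybar i - y' i) (s.y i - y' i) -
        1 / 2 * ∑ i, I.Lk k i * ‖y' i - s.ybar i‖ ^ 2) +
      s.t * (∑ i, I.Lk k i * Inner.inner ℝ (s.ybar i - y' i) (xs i - y' i) -
        1 / 2 * ∑ i, I.Lk k i * ‖y' i - s.ybar i‖ ^ 2) =
      1 / 2 * ∑ i, I.Lk k i * ‖s.t • y' i - (s.t - 1) • s.y i - xs i‖ ^ 2 -
      1 / 2 * ∑ i, I.Lk k i * ‖s.t • s.ybar i - (s.t - 1) • s.y i - xs i‖ ^ 2 := by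
    simp only [Finset.mul_sum, ← Finset.sum_sub_distrib, ← Finset.sum_add_distrib]
    refine Finset.sum_congr rfl fun i _ => ?_
    have e1 : s.t • s.ybar i - (s.t - 1) • s.y i - xs i =
        s.t • (s.ybar i - y' i) - ((s.t - 1) • (s.y i - y' i) + (xs i - y' i)) := by module
    have e2 : s.t • y' i - (s.t - 1) • s.y i - xs i =
        -((s.t - 1) • (s.y i - y' i) + (xs i - y' i)) := by module
    rw [e1, e2, norm_neg, norm_sub_rev (y' i), norm_sub_sq_real (s.t • _), norm_smul,
      inner_smul_left, inner_add_right, inner_smul_right, mul_pow, Real.norm_eq_abs, sq_abs, conj_trivial]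
    ring
  nlinarith

theorem subproblem_inner_sub_le (hγ : ∀ i, InGamma (I.costs.gamma i) (I.L i))
    (hρ : ∀ i, InR (I.costs.rho i) (B i) (τ i)) (hA : IsConsensusMap I.G A)
    (hψ : 0 < psiMax I.G) (hlam : 0 < I.params.lam k) {S : OuterState N n}
    (hxbar : A S.xbar = -(I.params.lam k • θ)) {xs : Profile N n}
    (hxs : ∀ z, subproblem I.costs A 0 (I.params.lam k) θ xs ≤
      subproblem I.costs A 0 (I.params.lam k) θ z) (ℓ : ℕ) :
    (ℓ : ℝ) ^ 2 * (subproblem I.costs A 0 (I.params.lam k) θ (I.inner k S ℓ).y -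
      subproblem I.costs A 0 (I.params.lam k) θ xs) ≤
      2 * ∑ i, I.Lk k i * ‖S.x i - xs i‖ ^ 2 := by
  have ht : ∀ ℓ, 1 ≤ (I.inner k S ℓ).t := fun ℓ => by
    have := inner_t_ge (I := I) (k := k) S ℓ
    have : (0 : ℝ) ≤ ℓ := Nat.cast_nonneg ℓ
    linarith
  have hanti : ∀ ℓ, I.energy k A θ xs (I.inner k S ℓ) ≤ I.energy k A θ xs (I.inner k S 0) := by
    intro ℓ
    induction ℓ with
    | zero => rfl
    | succ ℓ ih =>
      rw [inner_succ]
      exact (energy_innerStep_le hγ hρ hA hψ hlam hxbar xs (ht ℓ)).trans ih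
  -- Initially `t = 1`, so the function value drops out of the energy.
  have h0 : I.energy k A θ xs (I.inner k S 0) = 1 / 2 * ∑ i, I.Lk k i * ‖S.x i - xs i‖ ^ 2 := by
    simp [energy, Input.inner]
  have h1 := (hanti ℓ).trans h0.le
  have h2 : 0 ≤ 1 / 2 * ∑ i, I.Lk k i * ‖(I.inner k S ℓ).t • (I.inner k S ℓ).ybar i -
      ((I.inner k S ℓ).t - 1) • (I.inner k S ℓ).y i - xs i‖ ^ 2 :=
    mul_nonneg (by norm_num) (Finset.sum_nonneg fun i _ =>
      mul_nonneg (Lk_pos hlam.le hψ i).le (sq_nonneg _))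
  unfold energy at h1
  have h3 := inner_t_ge (I := I) (k := k) S ℓ
  have h4 : (ℓ : ℝ) ^ 2 / 4 ≤ (I.inner k S ℓ).t * ((I.inner k S ℓ).t - 1) := by
    have : (0 : ℝ) ≤ ℓ := Nat.cast_nonneg ℓ
    nlinarith
  have h5 := mul_le_mul_of_nonneg_right h4 (sub_nonneg.2 (hxs (I.inner k S ℓ).y))
  linarith

theorem innerCount_spec (k : ℕ) (S : OuterState N n) :
    1 ≤ I.innerCount k S ∧ (I.test k S.xbar (I.inner k S (I.innerCount k S - 1)).ybar ∨
      I.ellMax k ≤ I.innerCount k S) :=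
  Nat.sInf_mem (s := {ℓ : ℕ | 1 ≤ ℓ ∧ (I.test k S.xbar (I.inner k S (ℓ - 1)).ybar ∨
    I.ellMax k ≤ ℓ)}) ⟨⌈I.ellMax k⌉₊ + 1, by omega, Or.inr (by
      push_cast
      linarith [Nat.le_ceil (I.ellMax k)])⟩

theorem innerCount_le (k : ℕ) (S : OuterState N n) : I.innerCount k S ≤ ⌈I.ellMax k⌉₊ + 1 :=
  Nat.sInf_le ⟨by omega, Or.inr (by
    push_cast
    linarith [Nat.le_ceil (I.ellMax k)])⟩

/-- `ℓ_max` is exactly the `ℓ` at which the rate bound `2 ∑ L_i B_x² / ℓ²` reaches `alpha`. -/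
theorem innerOutput_inexact (hγ : ∀ i, InGamma (I.costs.gamma i) (I.L i))
    (hρ : ∀ i, InR (I.costs.rho i) (B i) (τ i)) (hA : IsConsensusMap I.G A)
    (hψ : 0 < psiMax I.G) (hlam : 0 < I.params.lam k) (halpha : 0 < I.params.alpha k)
    (hBx : 0 ≤ I.Bx) {S : OuterState N n}
    (hxbar : A S.xbar = -(I.params.lam k • θ)) {xs : Profile N n}
    (hxs : ∀ z, subproblem I.costs A 0 (I.params.lam k) θ xs ≤
      subproblem I.costs A 0 (I.params.lam k) θ z) (hdist : ∀ i, ‖S.x i - xs i‖ ≤ I.Bx) :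
    InexactA I.costs A 0 (I.params.lam k) (I.params.alpha k) θ (I.innerOutput k S) ∨
      InexactB I.costs A 0 (I.params.lam k) (I.params.xi k) θ (I.innerOutput k S) := by
  obtain ⟨hpos, hor⟩ := innerCount_spec (I := I) k S
  by_cases htest : I.test k S.xbar (I.inner k S (I.innerCount k S - 1)).ybar
  · right
    simp only [innerOutput, if_pos htest]
    intro i
    obtain ⟨v, hv, hle⟩ := htest i
    refine ⟨v, hv, ?_⟩
    rwa [gradient_smoothPart hγ, ← q_eq_smoothGrad hA hxbar, add_comm]
  · left
    simp only [innerOutput, if_neg htest]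
    refine ⟨xs, hxs, ?_⟩
    have hell := hor.resolve_left htest
    set ℓ := I.innerCount k S
    have h1 := subproblem_inner_sub_le hγ hρ hA hψ hlam hxbar hxs ℓ
    have h2 : ∑ i, I.Lk k i * ‖S.x i - xs i‖ ^ 2 ≤ (∑ i, I.Lk k i) * I.Bx ^ 2 := by
      rw [Finset.sum_mul]
      exact Finset.sum_le_sum fun i _ => mul_le_mul_of_nonneg_left
        (pow_le_pow_left₀ (norm_nonneg _) (hdist i) 2) (Lk_pos hlam.le hψ i).le
    have hsum : 0 ≤ ∑ i, I.Lk k i := Finset.sum_nonneg fun i _ => (Lk_pos hlam.le hψ i).le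
    have h3 : I.ellMax k ^ 2 = I.Bx ^ 2 * (2 * (∑ i, I.Lk k i) / I.params.alpha k) := by
      rw [ellMax, mul_pow, Real.sq_sqrt (by positivity)]
    have h4 : I.ellMax k ^ 2 ≤ (ℓ : ℝ) ^ 2 :=
      pow_le_pow_left₀ (mul_nonneg hBx (Real.sqrt_nonneg _)) hell 2
    have h5 : 2 * ((∑ i, I.Lk k i) * I.Bx ^ 2) ≤ (ℓ : ℝ) ^ 2 * I.params.alpha k := by
      calc _ = I.ellMax k ^ 2 * I.params.alpha k := by
            rw [h3]
            field_simp
        _ ≤ _ := mul_le_mul_of_nonneg_right h4 halpha.le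
    have hℓ : (0 : ℝ) < (ℓ : ℝ) ^ 2 := by positivity
    refine le_of_mul_le_mul_left ?_ hℓ
    linarith

theorem inner_cost (S : OuterState N n) (ℓ : ℕ) (i : Fin N) :
    (I.inner k S ℓ).cost.grad i = S.cost.grad i + ℓ ∧
    (I.inner k S ℓ).cost.prox i = S.cost.prox i + ℓ ∧
    (I.inner k S ℓ).cost.comm i = S.cost.comm i + ℓ := by
  induction ℓ with
  | zero => simp [Input.inner]
  | succ ℓ ih =>
    obtain ⟨h1, h2, h3⟩ := ih
    rw [inner_succ]
    simp only [innerStep, h1, h2, h3]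
    omega

end Input

end InnerLoop

/-! ### Decay of the parameters -/

section Params

/-- The standing assumptions on the parameters. -/
structure Params.Admissible (p : Params) (a s : ℝ) : Prop where
  c_pos : 0 < p.c
  c_lt_one : p.c < 1
  lam1_pos : 0 < p.lam1
  alpha1_pos : 0 < p.alpha1
  alpha1_le : p.alpha1 ≤ a * p.lam1 ^ 2
  xi1_pos : 0 < p.xi1
  xi1_le : p.xi1 ≤ s * p.lam1

namespace Params.Admissible

variable {p : Params} {a s : ℝ}

theorem lam_pos (hp : p.Admissible a s) (k : ℕ) : 0 < p.lam k := mul_pos (pow_pos hp.c_pos _) hp.lam1_pos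

theorem lam_le (hp : p.Admissible a s) (k : ℕ) : p.lam k ≤ p.lam1 :=
  mul_le_of_le_one_left hp.lam1_pos.le (pow_le_one₀ hp.c_pos.le hp.c_lt_one.le)

theorem alpha_pos (hp : p.Admissible a s) (k : ℕ) : 0 < p.alpha k := mul_pos (pow_pos (pow_pos hp.c_pos 2) _) hp.alpha1_pos

theorem alpha_le (hp : p.Admissible a s) (k : ℕ) : p.alpha k ≤ a * p.lam k ^ 2 := by
  have := mul_le_mul_of_nonneg_left hp.alpha1_le (pow_nonneg (sq_nonneg p.c) (k - 1))
  unfold Params.alpha Params.lam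
  refine this.trans_eq ?_
  rw [← pow_mul, mul_comm 2, pow_mul]
  ring

theorem xi_pos (hp : p.Admissible a s) (k : ℕ) : 0 < p.xi k := mul_pos (pow_pos (pow_pos hp.c_pos 2) _) hp.xi1_pos

theorem xi_le_sq (hp : p.Admissible a s) (k : ℕ) : p.xi k ≤ s / p.lam1 * p.lam k ^ 2 := by
  have := mul_le_mul_of_nonneg_left hp.xi1_le (pow_nonneg (sq_nonneg p.c) (k - 1))
  have hne := hp.lam1_pos.ne'
  unfold Params.xi Params.lam
  refine this.trans_eq ?_
  rw [← pow_mul, mul_comm 2, pow_mul]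
  field_simp

theorem xi_le (hp : p.Admissible a s) (k : ℕ) (hs : 0 ≤ s) : p.xi k ≤ s * p.lam k := by
  refine (hp.xi_le_sq k).trans ?_
  rw [div_mul_eq_mul_div, div_le_iff₀ hp.lam1_pos, sq, mul_assoc]
  exact mul_le_mul_of_nonneg_left
    (mul_le_mul_of_nonneg_left (hp.lam_le k) (hp.lam_pos k).le) hs

end Params.Admissible

end Params

/-! ### Outer rate, implementation and work count for one graph -/

section Assembly

variable {N n : ℕ} {P : Costs N n} {L : Fin N → ℝ≥0} {B τ : Fin N → ℝ} {G : SimpleGraph (Fin N)}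
  {p : Params} {a s X T Λ : ℝ}

theorem IsDFAL.multiplier_mem (h : StepBounds P G a s X T Λ) (hT : 0 ≤ T) (hs : 0 ≤ s)
    (hp : p.Admissible a s) (hΛ : p.lam1 ≤ Λ) {m : ℕ}
    {A : Profile N n →L[ℝ] EuclideanSpace ℝ (Fin m)} (hA : IsConsensusMap G A)
    {x : ℕ → Profile N n} {θ : ℕ → EuclideanSpace ℝ (Fin m)} (hx : IsDFAL P p A 0 x θ)
    {k : ℕ} (hk : 1 ≤ k) : ∃ w, θ k = A w ∧ ‖A w‖ ≤ T := by
  induction k, hk using Nat.le_induction with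
  | base => exact ⟨0, by rw [hx.init, map_zero], by rwa [map_zero, norm_zero]⟩
  | succ k hk ih =>
    obtain ⟨w, hw, hwT⟩ := ih
    have h1 := hx.primal k hk
    rw [hw] at h1
    refine ⟨w - (1 / p.lam k) • x k, ?_, ?_⟩
    · rw [hx.dual k hk, hw, sub_zero, map_sub, map_smul]
    · rw [map_sub, map_smul]
      exact (h m A hA _ _ _ w (x k) (hp.lam_pos k) ((hp.lam_le k).trans hΛ) (hp.alpha_pos k).le
        (hp.alpha_le k) (hp.xi_pos k).le (hp.xi_le k hs) hwT h1).2

theorem IsConsensusDFAL.exists_rate (hN : 2 ≤ N) (hG : G.Connected)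
    (hγ : ∀ i, InGamma (P.gamma i) (L i)) (hρ : ∀ i, InR (P.rho i) (B i) (τ i))
    (h : StepBounds P G a s X T Λ) (hX : 0 < X) (hT : 0 ≤ T) (ha : 0 < a) (hs : 0 ≤ s)
    (hp : p.Admissible a s) (hΛ : p.lam1 ≤ Λ) :
    ∃ D : ℝ, 0 < D ∧ ∀ x : ℕ → Profile N n, IsConsensusDFAL P p G x → ∀ k, 1 ≤ k →
      IsEpsOptimal P (D * p.c ^ (k - 1)) (x k) ∧ IsEpsFeasible G (D * p.c ^ (k - 1)) (x k) := by
  obtain ⟨D, hD, hrate⟩ := h.exists_rate hN hG hγ hρ hX hT ha (div_nonneg hs hp.lam1_pos.le)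
  refine ⟨D * p.lam1, mul_pos hD hp.lam1_pos, ?_⟩
  rintro x ⟨m, A, θ, hA, hx⟩ k hk
  obtain ⟨w, hw, hwT⟩ := hx.multiplier_mem h hT hs hp hΛ hA hk
  have h1 := hx.primal k hk
  rw [hw] at h1
  have e : D * p.lam1 * p.c ^ (k - 1) = D * p.lam k := by
    unfold Params.lam
    ring
  rw [e]
  exact hrate m A hA _ _ _ w (x k) (hp.lam_pos k) ((hp.lam_le k).trans hΛ) (hp.alpha_pos k).le
    (hp.alpha_le k) (hp.xi_pos k).le (hp.xi_le k hs) (hp.xi_le_sq k) hwT h1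

theorem isConsensusDFAL_run (hN : 2 ≤ N) (hG : G.Connected)
    (hγ : ∀ i, InGamma (P.gamma i) (L i)) (hρ : ∀ i, InR (P.rho i) (B i) (τ i))
    (h : StepBounds P G a s X T Λ) (hX : 0 < X) (hT : 0 ≤ T) (hs0 : 0 < s)
    (hs : ∀ i, s < τ i) (hp : p.Admissible a s) (hΛ : p.lam1 ≤ Λ) (x0 : Profile N n) {Bx : ℝ}
    (hBx : 2 * X + ∑ i, ‖x0 i‖ ≤ Bx) :
    IsConsensusDFAL P p G fun k => ((Input.mk P L p G Bx).run x0 k).x := by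
  obtain ⟨m, A, hA⟩ := exists_isConsensusMap G n
  set I : Input N n := Input.mk P L p G Bx with hI
  set R : ℝ := X + ∑ i, ‖x0 i‖ with hR
  have hR0 : 0 ≤ ∑ i, ‖x0 i‖ := Finset.sum_nonneg fun i _ => norm_nonneg _
  have hψ := psiMax_pos hN hG
  -- A preimage under `A` of the multiplier. The state before pass `k` is `run x0 (k - 1)`.
  let w : ℕ → Profile N n := fun k => -((1 / p.lam k) • (I.run x0 (k - 1)).xbar)
  have hw : ∀ k, w (k + 2) = w (k + 1) - (1 / p.lam (k + 1)) • (I.run x0 (k + 1)).x := by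
    intro k
    have e : (I.run x0 (k + 1)).xbar =
        (p.lam (k + 2) / p.lam (k + 1)) • ((I.run x0 k).xbar + (I.run x0 (k + 1)).x) := rfl
    have h1 := (hp.lam_pos (k + 1)).ne'
    have h2 := (hp.lam_pos (k + 2)).ne'
    have e2 : 1 / p.lam (k + 2) * (p.lam (k + 2) / p.lam (k + 1)) = 1 / p.lam (k + 1) := by
      field_simp
    simp only [w]
    rw [show k + 2 - 1 = k + 1 by omega, show k + 1 - 1 = k by omega, e, smul_smul, e2]
    module
  have hstep : ∀ k, ‖A (w (k + 1))‖ ≤ T → (∀ i, ‖(I.run x0 k).x i‖ ≤ R) →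
      InexactA P A 0 (p.lam (k + 1)) (p.alpha (k + 1)) (A (w (k + 1))) (I.run x0 (k + 1)).x ∨
      InexactB P A 0 (p.lam (k + 1)) (p.xi (k + 1)) (A (w (k + 1))) (I.run x0 (k + 1)).x := by
    intro k hwk hxk
    obtain ⟨xs, hxs⟩ := exists_isMin_subproblem (A := A) (θ := A (w (k + 1))) hγ hρ hs0 hs
      (hp.lam_pos (k + 1))
    -- An exact minimizer satisfies (a), so it lies in the same ball as the iterates; this bounds
    -- its distance from the warm start by `Bx`.
    have hxsX := (h m A hA _ _ _ (w (k + 1)) xs (hp.lam_pos (k + 1)) ((hp.lam_le _).trans hΛ)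
      (hp.alpha_pos _).le (hp.alpha_le _) (hp.xi_pos _).le (hp.xi_le _ hs0.le) hwk
      (Or.inl ⟨xs, hxs, by rw [sub_self]; exact (hp.alpha_pos _).le⟩)).1
    refine Input.innerOutput_inexact (I := I) (k := k + 1) (S := I.run x0 k) hγ hρ hA hψ
      (hp.lam_pos _) (hp.alpha_pos _) ?_ ?_ hxs fun i => ?_
    · exact le_trans (by positivity) hBx
    · have h1 := (hp.lam_pos (k + 1)).ne'
      simp only [w, map_neg, map_smul, hI]
      rw [smul_neg, smul_smul, mul_one_div_cancel h1, one_smul, neg_neg]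
      rfl
    · exact (norm_sub_le _ _).trans ((add_le_add (hxk i) (hxsX i)).trans (by linarith))
  have hinv : ∀ k, ‖A (w (k + 1))‖ ≤ T ∧ ∀ i, ‖(I.run x0 k).x i‖ ≤ R := by
    intro k
    induction k with
    | zero =>
      constructor
      · simpa [w, Input.run] using hT
      · intro i
        have := Finset.single_le_sum (f := fun i => ‖x0 i‖) (fun i _ => norm_nonneg _)
          (Finset.mem_univ i)
        simp only [Input.run]
        linarith
    | succ k ih =>
      obtain ⟨h1, h2⟩ := h m A hA _ _ _ (w (k + 1)) _ (hp.lam_pos (k + 1)) ((hp.lam_le _).trans hΛ)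
        (hp.alpha_pos _).le (hp.alpha_le _) (hp.xi_pos _).le (hp.xi_le _ hs0.le) ih.1
        (hstep k ih.1 ih.2)
      refine ⟨?_, fun i => (h1 i).trans (by linarith)⟩
      rw [hw, map_sub, map_smul]
      exact h2
  refine ⟨m, A, fun k => A (w k), hA, ⟨?_, ?_, ?_⟩⟩
  · simp [w, Input.run]
  · intro k hk
    obtain ⟨j, rfl⟩ := Nat.exists_eq_add_of_le' hk
    exact hstep j (hinv j).1 (hinv j).2
  · intro k hk
    obtain ⟨j, rfl⟩ := Nat.exists_eq_add_of_le' hk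
    rw [hw, map_sub, map_smul, sub_zero]

/-- The `L_i` do not increase with `k`, and `alpha` shrinks by `c²` per pass, so the square root
grows by at most `1/c`. -/
theorem Input.ellMax_le (I : Input N n) (hp : I.params.Admissible a s)
    (hBx : 0 ≤ I.Bx) (k : ℕ) : I.ellMax (k + 1) ≤ I.ellMax 1 * I.params.c⁻¹ ^ k := by
  unfold Input.ellMax
  rw [mul_assoc]
  refine mul_le_mul_of_nonneg_left ?_ hBx
  have hc : 0 ≤ I.params.c⁻¹ ^ k := pow_nonneg (inv_nonneg.2 hp.c_pos.le) _
  rw [← Real.sqrt_sq hc, ← Real.sqrt_mul' _ (sq_nonneg _)]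
  refine Real.sqrt_le_sqrt ?_
  have e : I.params.alpha (k + 1) = (I.params.c ^ k) ^ 2 * I.params.alpha 1 := by
    simp [Params.alpha, ← pow_mul, mul_comm]
  have hle : ∑ i, I.Lk (k + 1) i ≤ ∑ i, I.Lk 1 i := by
    refine Finset.sum_le_sum fun i _ => ?_
    have h1 := hp.lam_le (k + 1)
    have h2 : I.params.lam 1 = I.params.lam1 := by simp [Params.lam]
    unfold Input.Lk
    rw [h2]
    gcongr
  have hα := hp.alpha_pos 1
  have hck : I.params.c ^ k ≠ 0 := (pow_pos hp.c_pos k).ne'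
  calc 2 * (∑ i, I.Lk (k + 1) i) / I.params.alpha (k + 1)
      ≤ 2 * (∑ i, I.Lk 1 i) / I.params.alpha (k + 1) := by
        have := hp.alpha_pos (k + 1)
        gcongr
    _ = _ := by
        rw [e, inv_pow]
        field_simp

theorem Input.run_cost_le (I : Input N n) (hp : I.params.Admissible a s)
    (hBx : 0 ≤ I.Bx) (x0 : Profile N n) (K : ℕ) (i : Fin N) :
    (I.run x0 K).cost.grad i ≤ (I.run x0 K).cost.comm i ∧
    (I.run x0 K).cost.prox i ≤ (I.run x0 K).cost.comm i ∧
    ((I.run x0 K).cost.comm i : ℝ) ≤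
      (I.ellMax 1 + 3) / (1 - I.params.c) * I.params.c⁻¹ ^ K := by
  have hell : 0 ≤ I.ellMax 1 := mul_nonneg hBx (Real.sqrt_nonneg _)
  have hc1 : 0 < 1 - I.params.c := sub_pos.2 hp.c_lt_one
  induction K with
  | zero =>
    simp only [Input.run, Pi.zero_apply, le_refl, true_and, Nat.cast_zero]
    positivity
  | succ K ih =>
    obtain ⟨h1, h2, h3⟩ := ih
    obtain ⟨e1, e2, e3⟩ := I.inner_cost (k := K + 1) (I.run x0 K)
      (I.innerCount (K + 1) (I.run x0 K)) i
    simp only [Input.run, Input.outerStep, e1, e2, e3]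
    refine ⟨by omega, by omega, ?_⟩
    have h4 : (I.innerCount (K + 1) (I.run x0 K) : ℝ) ≤ I.ellMax (K + 1) + 2 := by
      have h5 : (I.innerCount (K + 1) (I.run x0 K) : ℝ) ≤ ⌈I.ellMax (K + 1)⌉₊ + 1 := by
        exact_mod_cast I.innerCount_le (K + 1) (I.run x0 K)
      have h6 := Nat.ceil_lt_add_one (a := I.ellMax (K + 1))
        (mul_nonneg hBx (Real.sqrt_nonneg _))
      linarith
    have h5 := I.ellMax_le hp hBx K
    have h6 : 1 ≤ I.params.c⁻¹ ^ K := one_le_pow₀ ((one_le_inv₀ hp.c_pos).2 hp.c_lt_one.le)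
    -- This absorbs the cost of one more pass into the geometric bound; it amounts to `(1 - c)² ≥
    -- 0`.
    have h7 : 1 / (1 - I.params.c) + 1 ≤ 1 / (1 - I.params.c) * I.params.c⁻¹ := by
      have := hp.c_pos
      rw [div_add_one hc1.ne', div_mul_eq_mul_div, div_le_div_iff_of_pos_right hc1, one_mul,
        le_inv_comm₀ (by linarith) hp.c_pos, ← one_div, le_div_iff₀ (by linarith)]
      nlinarith [sq_nonneg (1 - I.params.c)]
    have h8 := mul_le_mul_of_nonneg_left h7
      (mul_nonneg (add_nonneg hell zero_le_three) (zero_le_one.trans h6))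
    push_cast
    calc ((I.run x0 K).cost.comm i : ℝ) + I.innerCount (K + 1) (I.run x0 K) + 1
        ≤ (I.ellMax 1 + 3) / (1 - I.params.c) * I.params.c⁻¹ ^ K +
          (I.ellMax 1 + 3) * I.params.c⁻¹ ^ K := by linarith
      _ = (I.ellMax 1 + 3) * I.params.c⁻¹ ^ K * (1 / (1 - I.params.c) + 1) := by ring
      _ ≤ _ := h8
      _ = _ := by ring

/-- `K - 1` is the least `j` with `max D 1 * c ^ j ≤ ε`. Minimality gives `c^{-K} ≤ H / ε`, and
logarithms then bound `K`; `ε ≤ 1/2` lets `log (1/ε)` absorb the constant `log H ≥ 0`. -/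
theorem exists_pow_le_of_log {c D : ℝ} (hc0 : 0 < c) (hc1 : c < 1) (hD : 0 < D) :
    ∃ C : ℝ, 0 < C ∧ ∀ ε : ℝ, 0 < ε → ε ≤ 1 / 2 → ∃ K : ℕ, 1 ≤ K ∧
      (K : ℝ) ≤ C * Real.log (1 / ε) ∧ D * c ^ (K - 1) ≤ ε ∧ c⁻¹ ^ K ≤ C * ε⁻¹ := by
  have hci : 1 < c⁻¹ := (one_lt_inv₀ hc0).2 hc1
  set H : ℝ := max D 1 * c⁻¹ ^ 2 with hH
  have hD1 : 1 ≤ max D 1 := le_max_right _ _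
  have hH1 : 1 ≤ H := one_le_mul_of_one_le_of_one_le hD1 (one_le_pow₀ hci.le)
  have hlogc : 0 < Real.log c⁻¹ := Real.log_pos hci
  have hlog2 : 0 < Real.log 2 := Real.log_pos one_lt_two
  have hlogH : 0 ≤ Real.log H := Real.log_nonneg hH1
  have hC0 : 0 < (Real.log H / Real.log 2 + 1) / Real.log c⁻¹ := by positivity
  refine ⟨H + (Real.log H / Real.log 2 + 1) / Real.log c⁻¹, by positivity, fun ε hε hε2 => ?_⟩
  have hex : ∃ j : ℕ, max D 1 * c ^ j ≤ ε := by
    obtain ⟨j, hj⟩ := exists_pow_lt_of_lt_one (div_pos hε (zero_lt_one.trans_le hD1)) hc1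
    exact ⟨j, by rw [mul_comm, ← le_div_iff₀ (zero_lt_one.trans_le hD1)]; exact hj.le⟩
  classical
  set j := Nat.find hex with hj
  have hspec : max D 1 * c ^ j ≤ ε := Nat.find_spec hex
  have hupper : c⁻¹ ^ (j + 1) ≤ H * ε⁻¹ := by
    rw [← div_eq_mul_inv, le_div_iff₀ hε]
    rcases Nat.eq_zero_or_pos j with h0 | h0
    · rw [h0, zero_add, pow_one, hH]
      have : c⁻¹ * ε ≤ c⁻¹ * (max D 1 * c⁻¹) := by
        refine mul_le_mul_of_nonneg_left ?_ (by positivity)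
        have := one_le_mul_of_one_le_of_one_le hD1 hci.le
        linarith
      linarith
    · have hlt := Nat.find_min hex (m := j - 1) (by omega)
      push Not at hlt
      have e : c⁻¹ ^ (j + 1) * c ^ (j - 1) = c⁻¹ ^ 2 := by
        rw [show j + 1 = (j - 1) + 2 by omega, pow_add, mul_right_comm, ← mul_pow,
          inv_mul_cancel₀ hc0.ne', one_pow, one_mul]
      calc c⁻¹ ^ (j + 1) * ε ≤ c⁻¹ ^ (j + 1) * (max D 1 * c ^ (j - 1)) := by gcongr
        _ = max D 1 * (c⁻¹ ^ (j + 1) * c ^ (j - 1)) := by ring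
        _ = H := by rw [e]
  refine ⟨j + 1, by omega, ?_, ?_, ?_⟩
  · have h1 := Real.log_le_log (by positivity) hupper
    rw [Real.log_pow, Real.log_mul (by positivity) (by positivity)] at h1
    have h2 : Real.log 2 ≤ Real.log ε⁻¹ :=
      Real.log_le_log two_pos (by rw [le_inv_comm₀ two_pos hε]; linarith)
    have h3 : Real.log H ≤ Real.log H / Real.log 2 * Real.log ε⁻¹ := by
      rw [div_mul_eq_mul_div, le_div_iff₀ hlog2]
      exact mul_le_mul_of_nonneg_left h2 hlogH
    have h4 : ((j + 1 : ℕ) : ℝ) ≤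
        (Real.log H / Real.log 2 + 1) / Real.log c⁻¹ * Real.log ε⁻¹ := by
      rw [div_mul_eq_mul_div, le_div_iff₀ hlogc]
      linarith
    rw [one_div]
    nlinarith [mul_nonneg (zero_le_one.trans hH1) (hlog2.le.trans h2)]
  · rw [Nat.add_sub_cancel]
    exact (mul_le_mul_of_nonneg_right (le_max_left _ _) (by positivity)).trans hspec
  · exact hupper.trans (mul_le_mul_of_nonneg_right (by linarith) (by positivity))

/-- The assertions about one graph, with the constant `C`. -/
def GraphBounds (P : Costs N n) (L : Fin N → ℝ≥0) (p : Params) (Bx : ℝ) (x0 : Profile N n)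
    (G : SimpleGraph (Fin N)) (C : ℝ) : Prop :=
  (∀ x : ℕ → Profile N n, IsConsensusDFAL P p G x →
    Tendsto (fun k => P.total (x k)) atTop (𝓝 P.optVal)) ∧
  IsConsensusDFAL P p G (fun k => ((Input.mk P L p G Bx).run x0 k).x) ∧
  ∀ ε : ℝ, 0 < ε → ε ≤ 1 / 2 →
    ∃ K : ℕ, 1 ≤ K ∧ (K : ℝ) ≤ C * Real.log (1 / ε) ∧
      (∀ x : ℕ → Profile N n, IsConsensusDFAL P p G x → ∀ k, K ≤ k →
        IsEpsOptimal P ε (x k) ∧ IsEpsFeasible G ε (x k)) ∧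
      ∀ i : Fin N,
        (((Input.mk P L p G Bx).run x0 K).cost.comm i : ℝ) ≤
          C * (psiMax G ^ (3 / 2 : ℝ) / (dMin G : ℝ)) * ε⁻¹ ∧
        (((Input.mk P L p G Bx).run x0 K).cost.grad i : ℝ) ≤ C * ε⁻¹ ∧
        (((Input.mk P L p G Bx).run x0 K).cost.prox i : ℝ) ≤ C * ε⁻¹

theorem GraphBounds.mono (hN : 2 ≤ N) (hG : G.Connected) {Bx C C' : ℝ} {x0 : Profile N n}
    (h : GraphBounds P L p Bx x0 G C) (hC : C ≤ C') : GraphBounds P L p Bx x0 G C' := by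
  refine ⟨h.1, h.2.1, fun ε hε hε2 => ?_⟩
  obtain ⟨K, hK, hKC, hx, hcost⟩ := h.2.2 ε hε hε2
  have hlog : 0 ≤ Real.log (1 / ε) :=
    Real.log_nonneg (by rw [le_div_iff₀ hε]; linarith)
  have hψ := psiMax_pos hN hG
  refine ⟨K, hK, hKC.trans (by gcongr), hx, fun i => ?_⟩
  obtain ⟨h1, h2, h3⟩ := hcost i
  exact ⟨h1.trans (by gcongr), h2.trans (by gcongr), h3.trans (by gcongr)⟩

theorem StepBounds.exists_graphBounds (hN : 2 ≤ N) (hG : G.Connected)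
    (hγ : ∀ i, InGamma (P.gamma i) (L i)) (hρ : ∀ i, InR (P.rho i) (B i) (τ i))
    (h : StepBounds P G a s X T Λ) (hX : 0 < X) (hT : 0 ≤ T) (ha : 0 < a) (hs0 : 0 < s)
    (hs : ∀ i, s < τ i) (hp : p.Admissible a s) (hΛ : p.lam1 ≤ Λ) (x0 : Profile N n) {Bx : ℝ}
    (hBx : 2 * X + ∑ i, ‖x0 i‖ ≤ Bx) :
    ∃ C : ℝ, GraphBounds P L p Bx x0 G C := by
  obtain ⟨D, hD, hrate⟩ := IsConsensusDFAL.exists_rate hN hG hγ hρ h hX hT ha hs0.le hp hΛ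
  obtain ⟨C, hC, hK⟩ := exists_pow_le_of_log hp.c_pos hp.c_lt_one hD
  have hψ := psiMax_pos hN hG
  have hd : (0 : ℝ) < dMin G := by exact_mod_cast dMin_pos hN hG
  set κ : ℝ := psiMax G ^ (3 / 2 : ℝ) / (dMin G : ℝ) with hκ
  have hκ0 : 0 < κ := div_pos (Real.rpow_pos_of_pos hψ _) hd
  set I : Input N n := Input.mk P L p G Bx
  have hBx0 : 0 ≤ Bx :=
    le_trans (add_nonneg (by linarith) (Finset.sum_nonneg fun i _ => norm_nonneg _)) hBx
  have hell : 0 ≤ I.ellMax 1 := mul_nonneg hBx0 (Real.sqrt_nonneg _)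
  have hc1 : 0 < 1 - p.c := sub_pos.2 hp.c_lt_one
  set E : ℝ := (I.ellMax 1 + 3) / (1 - p.c) with hE
  have hE0 : 0 ≤ E := div_nonneg (by linarith) hc1.le
  have hEC := mul_nonneg hE0 hC.le
  -- The summands serve `K`, the evaluation counts, and the communication count; division by `κ`
  -- introduces the graph factor into the last, so this constant depends on the graph.
  refine ⟨C + E * C + E * C / κ, ?_, isConsensusDFAL_run hN hG hγ hρ h hX hT hs0 hs hp hΛ x0 hBx,
    fun ε hε hε2 => ?_⟩
  · intro x hx
    rw [tendsto_iff_dist_tendsto_zero, ← tendsto_add_atTop_iff_nat 1]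
    refine squeeze_zero (fun _ => dist_nonneg) (fun k => (hrate x hx (k + 1) (by omega)).1) ?_
    simpa using (tendsto_pow_atTop_nhds_zero_of_lt_one hp.c_pos.le hp.c_lt_one).const_mul D
  · obtain ⟨K, hK1, hKlog, hKε, hKc⟩ := hK ε hε hε2
    have hlog : 0 ≤ Real.log (1 / ε) :=
      Real.log_nonneg (by rw [le_div_iff₀ hε]; linarith)
    have hdiv : 0 ≤ E * C / κ := div_nonneg hEC hκ0.le
    refine ⟨K, hK1, hKlog.trans (mul_le_mul_of_nonneg_right (by linarith) hlog),
      fun x hx k hk => ?_, fun i => ?_⟩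
    · have hle : D * p.c ^ (k - 1) ≤ ε := le_trans (mul_le_mul_of_nonneg_left
        (pow_le_pow_of_le_one hp.c_pos.le hp.c_lt_one.le (by omega)) hD.le) hKε
      obtain ⟨h1, h2⟩ := hrate x hx k (hK1.trans hk)
      exact ⟨le_trans h1 hle, fun i j hij => (h2 i j hij).trans hle⟩
    · obtain ⟨h1, h2, h3⟩ := I.run_cost_le hp hBx0 x0 K i
      have h4 : ((I.run x0 K).cost.comm i : ℝ) ≤ E * C * ε⁻¹ := by
        refine h3.trans ?_
        rw [mul_assoc]
        exact mul_le_mul_of_nonneg_left hKc hE0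
      have hε' : 0 < ε⁻¹ := inv_pos.2 hε
      have h5 : E * C * ε⁻¹ ≤ (C + E * C + E * C / κ) * ε⁻¹ :=
        mul_le_mul_of_nonneg_right (by linarith) hε'.le
      refine ⟨h4.trans (mul_le_mul_of_nonneg_right ?_ hε'.le), ?_, ?_⟩
      · have : E * C / κ * κ = E * C := div_mul_cancel₀ _ hκ0.ne'
        nlinarith
      · exact le_trans (Nat.cast_le.2 h1) (h4.trans h5)
      · exact le_trans (Nat.cast_le.2 h2) (h4.trans h5)

end Assembly

end DFAL

/-! ### Uniformity over the finitely many graphs -/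

theorem mainTheorem1 {N n : ℕ} (hN : 2 ≤ N)
    (P : DFAL.Costs N n) (L : Fin N → ℝ≥0) (B τ : Fin N → ℝ)
    (hγ : ∀ i, DFAL.InGamma (P.gamma i) (L i))
    (hρ : ∀ i, DFAL.InR (P.rho i) (B i) (τ i))
    (c : ℝ) (hc0 : 0 < c) (hc1 : c < 1)
    (a s : ℝ) (ha : 0 < a) (hs0 : 0 < s) (hs : ∀ i, s < τ i)
    (x0 : DFAL.Profile N n) :
    IsLeast (range P.central) P.optVal ∧
    ∃ lamBar : ℝ, 0 < lamBar ∧ ∃ Bx0 : ℝ, 0 < Bx0 ∧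
      ∀ p : DFAL.Params, p.c = c → 0 < p.lam1 → p.lam1 ≤ lamBar →
        0 < p.alpha1 → p.alpha1 ≤ a * p.lam1 ^ 2 → 0 < p.xi1 → p.xi1 ≤ s * p.lam1 →
      ∀ Bx : ℝ, Bx0 ≤ Bx →
      ∃ C : ℝ, 0 < C ∧ ∀ G : SimpleGraph (Fin N), G.Connected →
        (∀ x : ℕ → DFAL.Profile N n, DFAL.IsConsensusDFAL P p G x →
          Tendsto (fun k => P.total (x k)) atTop (𝓝 P.optVal)) ∧
        DFAL.IsConsensusDFAL P p G (fun k => ((DFAL.Input.mk P L p G Bx).run x0 k).x) ∧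
        ∀ ε : ℝ, 0 < ε → ε ≤ 1 / 2 →
          ∃ K : ℕ, 1 ≤ K ∧ (K : ℝ) ≤ C * Real.log (1 / ε) ∧
            (∀ x : ℕ → DFAL.Profile N n, DFAL.IsConsensusDFAL P p G x → ∀ k, K ≤ k →
              DFAL.IsEpsOptimal P ε (x k) ∧ DFAL.IsEpsFeasible G ε (x k)) ∧
            ∀ i : Fin N,
              (((DFAL.Input.mk P L p G Bx).run x0 K).cost.comm i : ℝ) ≤
                C * (DFAL.psiMax G ^ (3 / 2 : ℝ) / (DFAL.dMin G : ℝ)) * ε⁻¹ ∧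
              (((DFAL.Input.mk P L p G Bx).run x0 K).cost.grad i : ℝ) ≤ C * ε⁻¹ ∧
              (((DFAL.Input.mk P L p G Bx).run x0 K).cost.prox i : ℝ) ≤ C * ε⁻¹ := by
  refine ⟨DFAL.isLeast_optVal (by omega) hγ hρ, ?_⟩
  -- Disconnected graphs get dummy constants, so that extrema can be taken over all graphs.
  have hstep : ∀ G : SimpleGraph (Fin N), ∃ X T Λ : ℝ, 0 < X ∧ 0 ≤ T ∧ 0 < Λ ∧
      (G.Connected → DFAL.StepBounds P G a s X T Λ) := fun G => by
    by_cases hG : G.Connected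
    · obtain ⟨X, T, Λ, hX, hT, hΛ, h⟩ := DFAL.exists_stepBounds hN hG hγ hρ ha hs0 hs
      exact ⟨X, T, Λ, hX, hT, hΛ, fun _ => h⟩
    · exact ⟨1, 0, 1, one_pos, le_rfl, one_pos, fun h => absurd h hG⟩
  choose X T Λ hX hT hΛ hSB using hstep
  -- The smallest threshold and the largest primal radius work for every graph, and they are fixed
  -- before the parameters.
  obtain ⟨G₁, hG₁⟩ := Finite.exists_min Λ
  obtain ⟨G₂, hG₂⟩ := Finite.exists_max X
  have hx0 : 0 ≤ ∑ i, ‖x0 i‖ := Finset.sum_nonneg fun i _ => norm_nonneg _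
  refine ⟨Λ G₁, hΛ G₁, 2 * X G₂ + ∑ i, ‖x0 i‖, by linarith [hX G₂], ?_⟩
  intro p hpc hlam hlam' hα hα' hξ hξ' Bx hBx
  have hp : p.Admissible a s := ⟨hpc ▸ hc0, hpc ▸ hc1, hlam, hα, hα', hξ, hξ'⟩
  have hC : ∀ G : SimpleGraph (Fin N), ∃ C : ℝ,
      G.Connected → DFAL.GraphBounds P L p Bx x0 G C := fun G => by
    by_cases hG : G.Connected
    · obtain ⟨C, h⟩ := (hSB G hG).exists_graphBounds hN hG hγ hρ (hX G) (hT G) ha hs0 hs hp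
        (hlam'.trans (hG₁ G)) x0 (by linarith [hG₂ G])
      exact ⟨C, fun _ => h⟩
    · exact ⟨0, fun h => absurd h hG⟩
  choose C hCG using hC
  obtain ⟨G₃, hG₃⟩ := Finite.exists_max C
  exact ⟨max (C G₃) 1, lt_max_of_lt_right one_pos, fun G hG =>
    (hCG G hG).mono hN hG ((hG₃ G).trans (le_max_left _ _))⟩
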